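/- Let $\theta>0$ and $\Theta=\theta\begin{pmatrix}0&1\\-1&0\end{pmatrix}$. On the Schwartz space $\mathcal S=\mathcal S(\mathbb R^2,\mathbb C)$ consider the Moyal product $$(a\star b)(x)=\frac1{(\pi\theta)^2}\int\!\!\int a(x+y)\,b(x+z)\,e^{-2i\,y\Theta^{-1}z}\,dy\,dz ,$$ extended to products $a\star b$ with $a\in\mathcal S$, $b\in L^2(\mathbb R^2)$, and to products of a polynomial with an element of $\mathcal S$. Let $\mathcal H=L^2(\mathbb R^2)\otimes\mathbb C^2$, $\pi(a)(\psi_1,\psi_2)=(a\star\psi_1,a\star\psi_2)$ for $a\in\mathcal S$, and let $D=-i\sigma^\mu\partial_\mu$ with $\sigma^1=\begin{pmatrix}0&1\\1&0\end{pmatrix}$, $\sigma^2=\begin{pmatrix}0&i\\-i&0\end{pmatrix}$, with domain the smooth spinors that are square integrable together with all their derivatives. The spectral distance of two states $\omega_1,\omega_2$ (of the $C^*$-completion of $(\mathcal S,\star)$) is $$d(\omega_1,\omega_2)=\sup\{|\omega_1(a)-\omega_2(a)|:\ a\in\mathcal S,\ \|[D,\pi(a)]\|_{\rm op}\le 1\}\in[0,+\infty].$$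 A unit vector $\psi\in L^2(\mathbb R^2)$ defines the vector state $\omega_\psi(a)=\langle(\psi,0),\pi(a)(\psi,0)\rangle$. With $\bar z=\frac1{\sqrt2}(x_1-ix_2)$ let $f_{00}(x)=2e^{-(x_1^2+x_2^2)/\theta}$ and $f_{m0}=(\theta^m m!)^{-1/2}\,\bar z^{\star m}\star f_{00}$ for $m\in\mathbb N$, and for real $s>1$ put $$\psi(s)=\frac1{\sqrt{2\pi\theta}}\sum_{m\in\mathbb N}\sqrt{\frac1{\zeta(s)(m+1)^s}}\;f_{m0}\in L^2(\mathbb R^2),$$ where $\zeta$ is the Riemann zeta function. Then for all $s_1,s_2\in\left]1,\tfrac54\right[\,\cup\,\left]\tfrac54,\tfrac32\right]$ with $s_1\ne s_2$, the vectors $\psi(s_1)$ and $\psi(s_2)$ are unit vectors and $d(\omega_{\psi(s_1)},\omega_{\psi(s_2)})=+\infty$. -/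

import Mathlib

open MeasureTheory SchwartzMap LineDeriv
open scoped ENNReal ContDiff FourierTransform

noncomputable section

namespace Moyal

/-- The plane `ℝ²`, with its Euclidean structure and Lebesgue measure. -/
abbrev Plane : Type := EuclideanSpace ℝ (Fin 2)

/-- The fibre `ℂ²` of the trivial spinor bundle, with its Hilbert space structure. -/
abbrev Spinor : Type := EuclideanSpace ℂ (Fin 2)

/-! ### The Moyal product -/

/-- The antisymmetric matrix `Θ = θ (0 1; -1 0)`. -/
def Theta (θ : ℝ) : Matrix (Fin 2) (Fin 2) ℝ := θ • !![0, 1; -1, 0]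

/-- The bilinear form `y Θ⁻¹ z = y^μ (Θ⁻¹)_{μν} z^ν`. -/
def twist (θ : ℝ) (y z : Plane) : ℝ :=
  ∑ μ, ∑ ν, y μ * (Theta θ)⁻¹ μ ν * z ν

/-- The oscillating factor `exp (-2 i y Θ⁻¹ z)`. -/
def phase (θ : ℝ) (y z : Plane) : ℂ :=
  Complex.exp (-(2 * Complex.I * (twist θ y z : ℂ)))

/-- The Moyal product of two Schwartz functions,
`(a ⋆ b)(x) = (πθ)⁻² ∫∫ a(x+y) b(x+z) exp (-2 i y Θ⁻¹ z) dy dz`. -/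
def moyal (θ : ℝ) (a b : 𝓢(Plane, ℂ)) (x : Plane) : ℂ :=
  (((Real.pi * θ) ^ 2)⁻¹ : ℝ) *
    ∫ p : Plane × Plane, a (x + p.1) * b (x + p.2) * phase θ p.1 p.2

/-- The Moyal product `a ⋆ b` of a Schwartz function `a` with a square integrable function `b`:
the same integral, where the integration over the variable of the Schwartz function is carried out
first (its result is a rapidly decreasing function of `z`), so that both integrals converge
absolutely.  It agrees with `moyal` when `b` is a Schwartz function, see `leftMul_eq_moyal`. -/
def leftMul (θ : ℝ) (a : 𝓢(Plane, ℂ)) (b : Plane → ℂ) (x : Plane) : ℂ :=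
  (((Real.pi * θ) ^ 2)⁻¹ : ℝ) *
    ∫ z : Plane, (∫ y : Plane, a (x + y) * phase θ y z) * b (x + z)

/-- The Moyal product `u ⋆ g` of a function `u` of polynomial growth with a Schwartz function `g`:
the same integral, where again the integration over the variable of the Schwartz function is
carried out first.  It agrees with `moyal` when `u` is a Schwartz function, see
`polyMul_eq_moyal`. -/
def polyMul (θ : ℝ) (u : Plane → ℂ) (g : 𝓢(Plane, ℂ)) (x : Plane) : ℂ :=
  (((Real.pi * θ) ^ 2)⁻¹ : ℝ) *
    ∫ y : Plane, u (x + y) * ∫ z : Plane, g (x + z) * phase θ y z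

lemma twist_eq (θ : ℝ) (y z : Plane) : twist θ y z = (y 1 * z 0 - y 0 * z 1) / θ := by
  rcases eq_or_ne θ 0 with rfl | h
  · simp [twist, Theta]
  · have : (Theta θ)⁻¹ = !![0, -θ⁻¹; θ⁻¹, 0] := by
      apply Matrix.inv_eq_right_inv
      ext i j
      fin_cases i <;> fin_cases j <;> simp [Theta, Matrix.mul_apply, h]
    simp [twist, this]
    ring

lemma norm_phase (θ : ℝ) (y z : Plane) : ‖phase θ y z‖ = 1 := by
  simp [phase, Complex.norm_exp]

lemma continuous_phase (θ : ℝ) : Continuous fun p : Plane × Plane => phase θ p.1 p.2 := by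
  simp only [phase, twist_eq]
  fun_prop

lemma integrable_moyal (θ : ℝ) (a b : 𝓢(Plane, ℂ)) (x : Plane) :
    Integrable fun p : Plane × Plane => a (x + p.1) * b (x + p.2) * phase θ p.1 p.2 := by
  have h := (a.integrable (μ := volume).comp_add_left x).mul_prod
    (b.integrable (μ := volume).comp_add_left x)
  refine h.mul_bdd (c := 1) (continuous_phase θ).aestronglyMeasurable ?_
  exact Filter.Eventually.of_forall fun p => (norm_phase θ _ _).le

theorem leftMul_eq_moyal (θ : ℝ) (a b : 𝓢(Plane, ℂ)) (x : Plane) :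
    leftMul θ a b x = moyal θ a b x := by
  unfold leftMul moyal
  rw [Measure.volume_eq_prod, integral_prod_symm _ (integrable_moyal θ a b x)]
  congr 2
  ext z
  rw [← integral_mul_const]
  congr 1
  ext y
  ring

theorem polyMul_eq_moyal (θ : ℝ) (a b : 𝓢(Plane, ℂ)) (x : Plane) :
    polyMul θ a b x = moyal θ a b x := by
  unfold polyMul moyal
  rw [Measure.volume_eq_prod, integral_prod _ (integrable_moyal θ a b x)]
  congr 2
  ext y
  rw [← integral_const_mul]
  congr 1
  ext z
  ring

/-! ### The functions `f_{m0}` of the matrix base -/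

/-- The complex coordinate `z̄ = (x₁ - i x₂) / √2`. -/
def zbar (x : Plane) : ℂ := ((x 0 : ℂ) - Complex.I * (x 1 : ℂ)) / (Real.sqrt 2 : ℂ)

lemma zbar_temperate : zbar.HasTemperateGrowth := by
  let L : Plane →L[ℝ] ℂ :=
    ((Real.sqrt 2 : ℂ)⁻¹ : ℂ) • (Complex.ofRealCLM.comp (EuclideanSpace.proj (𝕜 := ℝ) 0) -
      Complex.I • Complex.ofRealCLM.comp (EuclideanSpace.proj (𝕜 := ℝ) 1))
  have : zbar = L := by
    ext x
    simp [zbar, L, div_eq_inv_mul]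
  rw [this]
  exact L.hasTemperateGrowth

/-- The standard basis vectors of the plane. -/
def e (μ : Fin 2) : Plane := EuclideanSpace.single μ 1

/-- The Moyal product `z̄ ⋆ g` with a Schwartz function `g`, as a Schwartz function:
`z̄ ⋆ g = z̄ g - (θ/2) ∂g` where `∂ = (∂₁ - i ∂₂) / √2`.  That this is the value of the Moyal
integral is `zbarStar_apply`. -/
def zbarStar (θ : ℝ) (g : 𝓢(Plane, ℂ)) : 𝓢(Plane, ℂ) :=
  smulLeftCLM ℂ zbar g -
    ((θ / 2 : ℝ) : ℂ) • ((Real.sqrt 2 : ℂ)⁻¹ • (∂_{e 0} g - Complex.I • ∂_{e 1} g))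

/-- The rotation by a quarter turn `y ↦ (y₂, -y₁)`. -/
def rot : Plane ≃ₗᵢ[ℝ] Plane where
  toFun y := !₂[y 1, -y 0]
  invFun y := !₂[-y 1, y 0]
  left_inv y := by ext i; fin_cases i <;> simp
  right_inv y := by ext i; fin_cases i <;> simp
  map_add' y z := by ext i; fin_cases i <;> simp; ring
  map_smul' c y := by ext i; fin_cases i <;> simp
  norm_map' y := by
    simp [EuclideanSpace.norm_eq, Fin.sum_univ_two, add_comm]

/-- `zbarStar` is the Moyal product with the coordinate function `z̄`. -/
theorem zbarStar_apply (θ : ℝ) (hθ : 0 < θ) (g : 𝓢(Plane, ℂ)) (x : Plane) :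
    zbarStar θ g x = polyMul θ zbar g x := by
  set h : 𝓢(Plane, ℂ) := compSubConstCLM ℂ (-x) g with hh
  have hx : ∀ z, h z = g (x + z) := fun z => by simp [hh, add_comm]
  have hpi := Real.pi_pos
  set c : ℝ := (Real.pi * θ)⁻¹ with hc
  have hcpos : 0 < c := by positivity
  -- the inner integral is a Fourier transform
  have hinner : ∀ y, ∫ z, g (x + z) * phase θ y z = (𝓕 h) (c • rot y) := by
    intro y
    rw [fourier_coe, Real.fourier_eq']
    congr 1
    ext z
    rw [hx, phase, twist_eq, smul_eq_mul, mul_comm]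
    congr 2
    simp [rot, PiLp.inner_apply, Fin.sum_univ_two, hc]
    field_simp
    ring
  have hz : ∀ y, zbar (x + y) = zbar x +
      ((Real.pi * θ / Real.sqrt 2 : ℝ) : ℂ) *
        (-((c • rot y) 1 : ℂ) - Complex.I * ((c • rot y) 0 : ℂ)) := by
    intro y
    have : (Real.sqrt 2 : ℂ) ≠ 0 := by simp
    have hθ' : (θ : ℂ) ≠ 0 := by exact_mod_cast hθ.ne'
    simp [zbar, rot, hc]
    field_simp
    ring
  have hint : ∀ m : Plane, Integrable (fun ξ : Plane => ((inner ℝ ξ m : ℝ) : ℂ) * (𝓕 h) ξ) ∧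
      ∫ ξ : Plane, ((inner ℝ ξ m : ℝ) : ℂ) * (𝓕 h) ξ =
        (2 * Real.pi * Complex.I)⁻¹ * (∂_{m} g) x := by
    intro m
    have ht : (inner ℝ · m : Plane → ℝ).HasTemperateGrowth := by fun_prop
    have e1 : ∀ ξ : Plane, ((inner ℝ ξ m : ℝ) : ℂ) * (𝓕 h) ξ =
        (2 * Real.pi * Complex.I)⁻¹ * (𝓕 (∂_{m} h)) ξ := by
      intro ξ
      rw [fourier_lineDerivOp_eq]
      have h2 : (2 * Real.pi * Complex.I : ℂ) ≠ 0 := by simp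
      rw [smul_apply, smulLeftCLM_apply_apply ht, smul_eq_mul, inv_mul_cancel_left₀ h2,
        Complex.real_smul]
    simp_rw [e1]
    refine ⟨(SchwartzMap.integrable _).const_mul _, ?_⟩
    rw [integral_const_mul]
    congr 1
    have e2 : ∫ ξ, (𝓕 (∂_{m} h)) ξ = (𝓕⁻ (𝓕 (∂_{m} h))) 0 := by
      rw [fourierInv_coe, Real.fourierInv_eq']
      simp
    rw [e2, FourierTransform.fourierInv_fourier_eq, lineDerivOp_apply_eq_fderiv, lineDerivOp_apply_eq_fderiv]
    have : (h : Plane → ℂ) = fun z => g (x + z) := funext hx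
    rw [this, fderiv_comp_add_left]
    simp
  have h0 : ∫ ξ, (𝓕 h) ξ = g x := by
    have e2 : ∫ ξ, (𝓕 h) ξ = (𝓕⁻ (𝓕 h)) 0 := by
      rw [fourierInv_coe, Real.fourierInv_eq']
      simp
    rw [e2, FourierTransform.fourierInv_fourier_eq, hx]; simp
  unfold polyMul
  simp_rw [hinner, hz]
  set F : Plane → ℂ := fun ξ => (zbar x + ((Real.pi * θ / Real.sqrt 2 : ℝ) : ℂ) *
        (-(ξ 1 : ℂ) - Complex.I * (ξ 0 : ℂ))) * (𝓕 h) ξ with hF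
  have hchange : ∫ y, F (c • rot y) = ((Real.pi * θ) ^ 2 : ℝ) * ∫ ξ, F ξ := by
    rw [(rot.measurePreserving).integral_comp rot.toHomeomorph.measurableEmbedding
      (fun y => F (c • y)), Measure.integral_comp_smul]
    have h3 : |(c ^ Module.finrank ℝ Plane)⁻¹| = (Real.pi * θ) ^ 2 := by
      rw [finrank_euclideanSpace_fin, hc, inv_pow, inv_inv, abs_of_nonneg (by positivity)]
    rw [h3, Complex.real_smul]
  change _ = _ * ∫ y, F (c • rot y)
  rw [hchange, ← mul_assoc, ← Complex.ofReal_mul, inv_mul_cancel₀ (by positivity)]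
  obtain ⟨i0, v0⟩ := hint (e 0)
  obtain ⟨i1, v1⟩ := hint (e 1)
  have hin : ∀ (ξ : Plane) (μ : Fin 2), inner ℝ ξ (e μ) = ξ μ := by
    intro ξ μ; simp [e, EuclideanSpace.inner_single_right]
  simp only [hin] at i0 v0 i1 v1
  have hFe : ∀ ξ, F ξ = zbar x * (𝓕 h) ξ - (((Real.pi * θ / Real.sqrt 2 : ℝ) : ℂ) * (((ξ 1 : ℝ) : ℂ) * (𝓕 h) ξ) +
     ((Real.pi * θ / Real.sqrt 2 : ℝ) : ℂ) * Complex.I * (((ξ 0 : ℝ) : ℂ) * (𝓕 h) ξ)) := by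
    intro ξ; simp only [hF]; ring
  simp_rw [hFe]
  rw [integral_sub, integral_add, integral_const_mul, integral_const_mul, integral_const_mul, h0, v0, v1]
  · have : (Real.sqrt 2 : ℂ) ≠ 0 := by simp
    have hp : (Real.pi : ℂ) ≠ 0 := by simp
    simp [zbarStar, smulLeftCLM_apply_apply zbar_temperate]
    field_simp
    ring_nf
    simp
    try ring
  · exact i1.const_mul _
  · exact i0.const_mul _
  · exact (SchwartzMap.integrable _).const_mul _
  · exact (i1.const_mul _).add (i0.const_mul _)
/-- The Hamiltonian `H = (x₁² + x₂²) / 2` of the harmonic oscillator. -/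
def ham (x : Plane) : ℝ := (x 0 ^ 2 + x 1 ^ 2) / 2

lemma ham_eq (x : Plane) : ham x = ‖x‖ ^ 2 / 2 := by
  simp [ham, EuclideanSpace.norm_sq_eq, Fin.sum_univ_two]

lemma ham_temperate (c : ℝ) : (fun x => c * ham x).HasTemperateGrowth := by
  have : (fun x => c * ham x) = fun x : Plane => (c / 2) * ‖x‖ ^ 2 := by
    ext x; rw [ham_eq]; ring
  rw [this]
  exact (Function.HasTemperateGrowth.const _).mul
    (Function.hasTemperateGrowth_norm_sq (H := Plane))

lemma pow_mul_exp_bounded (c : ℝ) (hc : 0 < c) (k : ℕ) :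
    ∃ M : ℝ, ∀ t : ℝ, 0 ≤ t → (1 + t) ^ k * Real.exp (-(c * t ^ 2)) ≤ M := by
  refine ⟨Nat.factorial k * Real.exp (1 + 1 / (4 * c)), fun t ht => ?_⟩
  have h1 : (1 + t) ^ k ≤ Nat.factorial k * Real.exp (1 + t) := by
    have := Real.pow_div_factorial_le_exp (1 + t) (by positivity) k
    rw [div_le_iff₀ (by positivity)] at this
    linarith
  have h2 : t - c * t ^ 2 ≤ 1 / (4 * c) := by
    rw [le_div_iff₀ (by positivity)]
    nlinarith [sq_nonneg (2 * c * t - 1)]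
  calc (1 + t) ^ k * Real.exp (-(c * t ^ 2))
      ≤ Nat.factorial k * Real.exp (1 + t) * Real.exp (-(c * t ^ 2)) := by gcongr
    _ = Nat.factorial k * Real.exp (1 + (t - c * t ^ 2)) := by
        rw [mul_assoc, ← Real.exp_add]; ring_nf
    _ ≤ _ := by gcongr

lemma gauss_decay (θ : ℝ) (hθ : 0 < θ) (k n : ℕ) :
    ∃ C : ℝ, ∀ x : Plane,
      ‖x‖ ^ k * ‖iteratedFDeriv ℝ n (fun x => Real.exp (-2 / θ * ham x)) x‖ ≤ C := by
  obtain ⟨j, K, hK, hb⟩ := (ham_temperate (-2 / θ)).norm_iteratedFDeriv_le_uniform n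
  obtain ⟨M, hM⟩ := pow_mul_exp_bounded (1 / θ) (by positivity) (k + j * n)
  refine ⟨n.factorial * (1 + K) ^ n * M, fun x => ?_⟩
  have hexp : ∀ i, i ≤ n → ‖iteratedFDeriv ℝ i Real.exp (-2 / θ * ham x)‖ ≤
      Real.exp (-2 / θ * ham x) := by
    intro i _
    rw [norm_iteratedFDeriv_eq_norm_iteratedDeriv, iteratedDeriv_eq_iterate, Real.iter_deriv_exp,
      Real.norm_of_nonneg (Real.exp_pos _).le]
  have hpow : (1 : ℝ) ≤ (1 + ‖x‖) ^ j := one_le_pow₀ (by simp)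
  have hD : ∀ i, 1 ≤ i → i ≤ n → ‖iteratedFDeriv ℝ i (fun x => -2 / θ * ham x) x‖ ≤
      ((1 + K) * (1 + ‖x‖) ^ j) ^ i := by
    intro i hi hin
    refine (hb i hin x).trans (le_trans ?_ (le_self_pow₀ ?_ (by omega)))
    · gcongr; linarith
    · nlinarith
  have h := norm_iteratedFDeriv_comp_le (𝕜 := ℝ) (n := n) (N := ∞)
    (Real.contDiff_exp (n := ∞)) (ham_temperate (-2 / θ)).1 (by exact_mod_cast le_top) x hexp hD
  have hh : -2 / θ * ham x = -(1 / θ * ‖x‖ ^ 2) := by rw [ham_eq]; ring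
  calc ‖x‖ ^ k * ‖iteratedFDeriv ℝ n (fun x => Real.exp (-2 / θ * ham x)) x‖
      ≤ (1 + ‖x‖) ^ k * (n.factorial * Real.exp (-2 / θ * ham x) *
          ((1 + K) * (1 + ‖x‖) ^ j) ^ n) := by
        gcongr
        · linarith
        · exact h
    _ = n.factorial * (1 + K) ^ n *
          ((1 + ‖x‖) ^ (k + j * n) * Real.exp (-(1 / θ * ‖x‖ ^ 2))) := by
        rw [hh, mul_pow, pow_add, pow_mul]; ring
    _ ≤ _ := by
        gcongr
        exact hM _ (norm_nonneg x)

/-- The real Gaussian `exp (-2H/θ)` as a Schwartz function. -/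
def gauss (θ : ℝ) (hθ : 0 < θ) : 𝓢(Plane, ℝ) where
  toFun x := Real.exp (-2 / θ * ham x)
  smooth' := Real.contDiff_exp.comp (ham_temperate (-2 / θ)).1
  decay' := gauss_decay θ hθ

/-- The function `f₀₀ = 2 exp (-2H/θ)` of the matrix base, see `f00_apply`. -/
def f00 (θ : ℝ) (hθ : 0 < θ) : 𝓢(Plane, ℂ) :=
  (2 : ℂ) • (gauss θ hθ).postcompCLM (𝕜 := ℝ) Complex.ofRealCLM

lemma f00_apply (θ : ℝ) (hθ : 0 < θ) (x : Plane) :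
    f00 θ hθ x = 2 * Real.exp (-2 * ham x / θ) := by
  have : f00 θ hθ x = 2 * Real.exp (-2 / θ * ham x) := by
    simp only [f00, smul_apply, postcompCLM_apply, smul_eq_mul]; rfl
  rw [this]; congr 3; ring

/-- The functions `f_{m0} = (θ^m m!)^{-1/2} z̄^{⋆m} ⋆ f₀₀` of the matrix base. -/
def basisFun (θ : ℝ) (hθ : 0 < θ) (m : ℕ) : 𝓢(Plane, ℂ) :=
  (((Real.sqrt (θ ^ m * m.factorial))⁻¹ : ℝ) : ℂ) • (zbarStar θ)^[m] (f00 θ hθ)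

/-- The vector `ψ(s) = (2πθ)^{-1/2} ∑ₘ (ζ(s) (m+1)^s)^{-1/2} f_{m0}`, the series being taken in
`L²(ℝ²)`. For real `s > 1` the value `ζ(s)` is real and positive. -/
def psi (θ : ℝ) (hθ : 0 < θ) (s : ℝ) : Lp ℂ 2 (volume : Measure Plane) :=
  ((1 / Real.sqrt (2 * Real.pi * θ) : ℝ) : ℂ) •
    ∑' m : ℕ, ((Real.sqrt (1 / ((riemannZeta (s : ℂ)).re * ((m : ℝ) + 1) ^ s)) : ℝ) : ℂ) •
      (basisFun θ hθ m).toLp 2 volume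

/-! ### The spectral triple and the spectral distance -/

/-- The matrices `σ¹ = (0 1; 1 0)` and `σ² = (0 i; -i 0)`. -/
def sigma : Fin 2 → Matrix (Fin 2) (Fin 2) ℂ :=
  ![!![0, 1; 1, 0], !![0, Complex.I; -Complex.I, 0]]

/-- The Dirac operator `D = -i σ^μ ∂_μ`. -/
def dirac (Ψ : Plane → Spinor) (x : Plane) : Spinor :=
  -(Complex.I • ∑ μ, WithLp.toLp 2 ((sigma μ).mulVec (fderiv ℝ Ψ x (e μ)).ofLp))

/-- The domain of the Dirac operator: smooth spinors which are square integrable together with all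
their derivatives. -/
def InDomD (Ψ : Plane → Spinor) : Prop :=
  ContDiff ℝ ∞ Ψ ∧ ∀ n : ℕ, MemLp (iteratedFDeriv ℝ n Ψ) 2 (volume : Measure Plane)

/-- The representation `π(a)(ψ₁, ψ₂) = (a ⋆ ψ₁, a ⋆ ψ₂)` of the algebra `(𝓢, ⋆)` on square
integrable spinors. -/
def rep (θ : ℝ) (a : 𝓢(Plane, ℂ)) (Ψ : Plane → Spinor) (x : Plane) : Spinor :=
  WithLp.toLp 2 fun i => leftMul θ a (fun w => Ψ w i) x

/-- The operator norm of the commutator `[D, π(a)]`: the supremum of `‖[D, π(a)]Ψ‖₂` over the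
spinors `Ψ` in the domain of `D` with `‖Ψ‖₂ ≤ 1`. -/
def commutatorNorm (θ : ℝ) (a : 𝓢(Plane, ℂ)) : ℝ≥0∞ :=
  ⨆ (Ψ : Plane → Spinor) (_ : InDomD Ψ) (_ : eLpNorm Ψ 2 volume ≤ 1),
    eLpNorm (fun x => dirac (rep θ a Ψ) x - rep θ a (dirac Ψ) x) 2 volume

/-- The vector state `ω_ψ(a) = ⟨(ψ, 0), π(a)(ψ, 0)⟩`, as a functional on the algebra `(𝓢, ⋆)`. -/
def vectorState (θ : ℝ) (ψ : Lp ℂ 2 (volume : Measure Plane)) (a : 𝓢(Plane, ℂ)) : ℂ :=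
  ∫ x : Plane, inner ℂ (!₂[ψ x, 0] : Spinor) (rep θ a (fun w => !₂[ψ w, 0]) x)

/-- The spectral distance `sup {|ω₁(a) - ω₂(a)| : a ∈ 𝓢, ‖[D, π(a)]‖ ≤ 1}`, possibly infinite.
It involves a state only through its restriction to the dense subalgebra `(𝓢, ⋆)`. -/
def spectralDist (θ : ℝ) (ω₁ ω₂ : 𝓢(Plane, ℂ) → ℂ) : ℝ≥0∞ :=
  ⨆ (a : 𝓢(Plane, ℂ)) (_ : commutatorNorm θ a ≤ 1), ‖ω₁ a - ω₂ a‖ₑ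

end Moyal

end

namespace Moyal

/-! ### An `L²` bound for integral operators dominated by a convolution -/

/-! The distance is bounded below by testing on Gaussians `a = r • f00 τ`, that is `2 r exp
(-|x|²/τ)`, of growing width `τ`.

Such an `a` is radial, so left Moyal multiplication by it is diagonal on the `f_{m0}`: the
eigenvalue is `r · 2τ/(τ+θ) · q^m` with `q = (τ-θ)/(τ+θ)` (`leftMul_f00_basisFun`). Since the
normalised `f_{m0}` are orthonormal, the state of `ψ(s)` evaluates `a` to `r · 2τ/(τ+θ)` times the
generating function `G_s(q) = ∑ p_s(m) q^m` of the zeta distribution `p_s(m) = 1/(ζ(s)(m+1)^s)`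
(`vectorState_psi_f00`).

Left multiplication is a twisted convolution with the symplectic Fourier transform `B` of `a`, and
commuting it with `∂_v` multiplies `B(z)` by `2 i v Θ⁻¹ z` (`fderiv_leftMul_sub`). By Young's
inequality `‖[D, π(a)]‖` is at most a constant times `∫ |z| |B(z)| dz`, which for a Gaussian scales
as `r τ^{-1/2}` (`exists_commutatorNorm_gaussian_le`). Hence `r` of order `√τ` is admissible.

Take `q = 1 - 1/n`, so that `τ` is of order `n`. It remains to see that `√n |G_s(q) - G_t(q)|` is
unbounded for `s < t ≤ 3/2` (`exists_lt_abs_tsum_zetaWeight_sub`). As both distributions have mass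
one, `G_t(q) - G_s(q) = ∑ (p_s(m) - p_t(m)) (1 - q^m)`. The heavier tail `p_s` wins far out, and the
indices `n ≤ m < 2n` alone contribute order `n^{1-s}`; the finitely many terms of uncertain sign
contribute `O(1/n)`. After multiplication by `√n` this gives `n^{3/2-s}`, which tends to infinity.
-/

/-- Cauchy–Schwarz for the splitting `k g = √k · (√k g)`. -/
lemma sq_lintegral_mul_le {k g : Plane → ℝ≥0∞} (hk : Measurable k) (hg : Measurable g) :
    (∫⁻ z, k z * g z) ^ 2 ≤ (∫⁻ z, k z) * ∫⁻ z, k z * g z ^ 2 := by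
  have hsq : ∀ a : ℝ≥0∞, (a ^ (1 / 2 : ℝ)) ^ (2 : ℝ) = a := fun a => by
    rw [← ENNReal.rpow_mul]; norm_num
  have hmul : ∀ a : ℝ≥0∞, a ^ (1 / 2 : ℝ) * a ^ (1 / 2 : ℝ) = a := fun a => by
    rw [← sq, ← ENNReal.rpow_two, hsq]
  have h := ENNReal.lintegral_mul_le_Lp_mul_Lq (volume : Measure Plane)
    (p := 2) (q := 2) (Real.holderConjugate_iff.mpr ⟨by norm_num, by norm_num⟩)
    (f := fun z => k z ^ (1 / 2 : ℝ)) (g := fun z => k z ^ (1 / 2 : ℝ) * g z)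
    (hk.pow_const _).aemeasurable ((hk.pow_const _).mul hg).aemeasurable
  simp only [Pi.mul_apply, ← mul_assoc, hmul, hsq,
    ENNReal.mul_rpow_of_nonneg _ _ (zero_le_two : (0 : ℝ) ≤ 2)] at h
  refine (pow_le_pow_left₀ (by simp) h 2).trans_eq ?_
  rw [mul_pow]
  simp only [← ENNReal.rpow_two, hsq]

/-- Young's inequality `L¹ * L² ⊂ L²`: the weighted Cauchy–Schwarz bound, then Tonelli and
translation invariance. -/
lemma lintegral_sq_conv_le {k g : Plane → ℝ≥0∞} (hk : Measurable k) (hg : Measurable g) :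
    ∫⁻ x, (∫⁻ z, k z * g (x + z)) ^ 2 ≤ (∫⁻ z, k z) ^ 2 * ∫⁻ z, g z ^ 2 := by
  calc ∫⁻ x, (∫⁻ z, k z * g (x + z)) ^ 2
      ≤ ∫⁻ x, (∫⁻ z, k z) * ∫⁻ z, k z * g (x + z) ^ 2 :=
        lintegral_mono fun x => sq_lintegral_mul_le hk (hg.comp (measurable_const_add x))
    _ = (∫⁻ z, k z) * ∫⁻ x, ∫⁻ z, k z * g (x + z) ^ 2 :=
        lintegral_const_mul _ (Measurable.lintegral_prod_right' (f := fun p : Plane × Plane =>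
          k p.2 * g (p.1 + p.2) ^ 2) (by fun_prop))
    _ = (∫⁻ z, k z) * ∫⁻ z, ∫⁻ x, k z * g (x + z) ^ 2 := by
        rw [lintegral_lintegral_swap]
        fun_prop
    _ = (∫⁻ z, k z) * ∫⁻ z, k z * ∫⁻ x, g x ^ 2 := by
        congr 1
        refine lintegral_congr fun z => ?_
        rw [lintegral_const_mul _ (by fun_prop),
          lintegral_add_right_eq_self (fun x => g x ^ 2) z]
    _ = _ := by rw [lintegral_mul_const _ hk]; ring

lemma eLpNorm_two_eq_lintegral {E : Type*} [NormedAddCommGroup E] (f : Plane → E) :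
    eLpNorm f 2 volume = (∫⁻ x, ‖f x‖ₑ ^ 2) ^ (1 / 2 : ℝ) := by
  rw [eLpNorm_eq_lintegral_rpow_enorm_toReal (by simp) (by simp)]
  simp

/-- Only pointwise domination of `f` is required, so the bound serves both for scalar left
multiplication and for the spinor-valued commutator. -/
lemma eLpNorm_le_of_le_conv {E F : Type*} [NormedAddCommGroup E] [NormedAddCommGroup F]
    {k : Plane → ℝ≥0∞} {G : Plane → E} {f : Plane → F} (hk : Measurable k)
    (hG : Measurable fun x => ‖G x‖ₑ) (h : ∀ x, ‖f x‖ₑ ≤ ∫⁻ z, k z * ‖G (x + z)‖ₑ) :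
    eLpNorm f 2 volume ≤ (∫⁻ z, k z) * eLpNorm G 2 volume := by
  have e2 : ∀ a : ℝ≥0∞, a = (a ^ 2) ^ (1 / 2 : ℝ) := fun a => by
    rw [← ENNReal.rpow_two, ← ENNReal.rpow_mul]; norm_num
  rw [eLpNorm_two_eq_lintegral f, eLpNorm_two_eq_lintegral G, e2 (∫⁻ z, k z), ← ENNReal.mul_rpow_of_nonneg _ _ (by norm_num)]
  refine ENNReal.rpow_le_rpow ?_ (by norm_num)
  exact (lintegral_mono fun x => pow_le_pow_left₀ (by simp) (h x) 2).trans
    (lintegral_sq_conv_le hk hG)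

/-! ### The Moyal product as a twisted convolution -/

lemma twist_add_left (θ : ℝ) (x y z : Plane) : twist θ (x + y) z = twist θ x z + twist θ y z := by
  simp only [twist_eq, PiLp.add_apply]; ring

lemma twist_sub_right (θ : ℝ) (x y z : Plane) : twist θ x (y - z) = twist θ x y - twist θ x z := by
  simp only [twist_eq, PiLp.sub_apply]; ring

lemma twist_swap (θ : ℝ) (x y : Plane) : twist θ x y = -twist θ y x := by
  simp only [twist_eq]; ring

lemma twist_self (θ : ℝ) (x : Plane) : twist θ x x = 0 := by
  simp only [twist_eq]; ring

lemma twist_neg_left (θ : ℝ) (x y : Plane) : twist θ (-x) y = -twist θ x y := by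
  simp only [twist_eq, PiLp.neg_apply]; ring

lemma abs_twist_le (θ : ℝ) (hθ : 0 < θ) (x y : Plane) : |twist θ x y| ≤ 2 / θ * (‖x‖ * ‖y‖) := by
  have hx := fun i => PiLp.norm_apply_le x i
  have hy := fun i => PiLp.norm_apply_le y i
  simp only [Real.norm_eq_abs] at hx hy
  have h1 : |x 1 * y 0| ≤ ‖x‖ * ‖y‖ := by
    rw [abs_mul]; exact mul_le_mul (hx 1) (hy 0) (abs_nonneg _) (norm_nonneg _)
  have h2 : |x 0 * y 1| ≤ ‖x‖ * ‖y‖ := by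
    rw [abs_mul]; exact mul_le_mul (hx 0) (hy 1) (abs_nonneg _) (norm_nonneg _)
  rw [twist_eq, abs_div, abs_of_pos hθ, div_mul_eq_mul_div]
  gcongr
  exact (abs_sub _ _).trans (by linarith)

/-- The linear form `x ↦ x Θ⁻¹ z`. -/
noncomputable def twistCLM (θ : ℝ) (z : Plane) : Plane →L[ℝ] ℝ :=
  (z 0 / θ) • EuclideanSpace.proj 1 - (z 1 / θ) • EuclideanSpace.proj 0

lemma twistCLM_apply (θ : ℝ) (x z : Plane) : twistCLM θ z x = twist θ x z := by
  simp [twistCLM, twist_eq]; ring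

lemma continuous_twistCLM (θ : ℝ) : Continuous (twistCLM θ) := by
  unfold twistCLM; fun_prop

lemma norm_twistCLM_le (θ : ℝ) (hθ : 0 < θ) (z : Plane) : ‖twistCLM θ z‖ ≤ 2 / θ * ‖z‖ := by
  refine ContinuousLinearMap.opNorm_le_bound _ (by positivity) fun x => ?_
  rw [twistCLM_apply, Real.norm_eq_abs]
  exact (abs_twist_le θ hθ x z).trans_eq (by ring)

lemma phase_neg_left (θ : ℝ) (x z : Plane) :
    phase θ (-x) z = Complex.exp (2 * Complex.I * (twist θ x z : ℂ)) := by
  rw [phase, twist_neg_left]; push_cast; ring_nf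

lemma phase_sub_right_self (θ : ℝ) (x w : Plane) : phase θ (-x) (w - x) = phase θ (-x) w := by
  rw [phase_neg_left, phase_neg_left, twist_sub_right, twist_self, sub_zero]

/-- Translating `y` by `x` in the inner integral extracts the phase `exp (2 i x Θ⁻¹ z)`. The
transform `B` of `a` enters as a hypothesis: it is explicit for the Gaussians to which this is
applied. -/
lemma leftMul_eq_twistedConv {θ : ℝ} {a B : 𝓢(Plane, ℂ)}
    (hB : ∀ z, ∫ y, a y * phase θ y z = B z) (b : Plane → ℂ) (x : Plane) :
    leftMul θ a b x =
      (((Real.pi * θ) ^ 2)⁻¹ : ℝ) * ∫ z, B z * phase θ (-x) z * b (x + z) := by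
  unfold leftMul
  congr 2
  ext z
  congr 1
  rw [← hB, ← integral_mul_const, ← integral_add_left_eq_self (fun y => a y * _ * _) x]
  congr 1
  ext y
  rw [mul_assoc, phase, phase, phase, ← Complex.exp_add, twist_add_left, twist_neg_left]
  congr 2
  push_cast
  ring

/-- With `w = x + z` the variable `x` occurs only in the smooth kernel, so one can differentiate
under the integral for `b` merely in `L²`. -/
lemma leftMul_eq_kernel {θ : ℝ} {a B : 𝓢(Plane, ℂ)}
    (hB : ∀ z, ∫ y, a y * phase θ y z = B z) (b : Plane → ℂ) (x : Plane) :
    leftMul θ a b x =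
      (((Real.pi * θ) ^ 2)⁻¹ : ℝ) * ∫ w, B (w - x) * phase θ (-x) w * b w := by
  rw [leftMul_eq_twistedConv hB]
  congr 1
  rw [← integral_add_left_eq_self (fun w => B (w - x) * phase θ (-x) w * b w) x]
  congr 1
  ext z
  rw [← phase_sub_right_self θ x (x + z)]
  simp

/-! ### Differentiating the kernel -/

/-- The derivative in `x` of the kernel `B (w - x) exp (2 i x Θ⁻¹ w)`. -/
noncomputable def kernelDeriv (θ : ℝ) (B : 𝓢(Plane, ℂ)) (x w : Plane) : Plane →L[ℝ] ℂ :=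
  phase θ (-x) w • (-(fderiv ℝ B (w - x)) +
    (2 * Complex.I * B (w - x)) • Complex.ofRealCLM.comp (twistCLM θ w))

lemma hasFDerivAt_kernel (θ : ℝ) (B : 𝓢(Plane, ℂ)) (x w : Plane) :
    HasFDerivAt (fun x => B (w - x) * phase θ (-x) w) (kernelDeriv θ B x w) x := by
  have h1 : HasFDerivAt (fun x => B (w - x)) (-(fderiv ℝ B (w - x))) x := by
    have := (B.differentiableAt (x := w - x)).hasFDerivAt.comp x ((hasFDerivAt_id x).const_sub w)
    refine this.congr_fderiv ?_
    ext; simp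
  have h2 : HasFDerivAt (fun x => phase θ (-x) w)
      (phase θ (-x) w • ((2 * Complex.I) • Complex.ofRealCLM.comp (twistCLM θ w))) x := by
    simp only [phase_neg_left, ← twistCLM_apply]
    have h3 : HasFDerivAt (fun x => ((twistCLM θ w x : ℝ) : ℂ))
      (Complex.ofRealCLM.comp (twistCLM θ w)) x :=
        (Complex.ofRealCLM.comp (twistCLM θ w)).hasFDerivAt
    exact (h3.const_mul (2 * Complex.I)).cexp
  refine (h1.mul h2).congr_fderiv ?_
  ext v
  simp [kernelDeriv]
  ring

/-- Decay in `w` that is locally uniform in `x`, as domination of derivatives requires; it rests on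
`1 + ‖w‖ ≤ (1 + ‖w - x‖)(2 + ‖x₀‖)`. -/
lemma exists_norm_kernel_le (B : 𝓢(Plane, ℂ)) (x₀ : Plane) (k : ℕ) :
    ∃ C : ℝ, 0 ≤ C ∧ ∀ w x : Plane, x ∈ Metric.ball x₀ 1 →
      ‖B (w - x)‖ ≤ C * ((1 + ‖w‖) ^ k)⁻¹ ∧ ‖fderiv ℝ B (w - x)‖ ≤ C * ((1 + ‖w‖) ^ k)⁻¹ := by
  set C₁ : ℝ := 2 ^ k * (Finset.Iic (k, 1)).sup (fun m => SchwartzMap.seminorm ℝ m.1 m.2) B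
  have hC : 0 ≤ C₁ := by positivity
  have key : ∀ w x : Plane, x ∈ Metric.ball x₀ 1 → ∀ r : ℝ, 0 ≤ r →
      (1 + ‖w - x‖) ^ k * r ≤ C₁ → r ≤ C₁ * (2 + ‖x₀‖) ^ k * ((1 + ‖w‖) ^ k)⁻¹ := by
    intro w x hx r hr h
    rw [← div_eq_mul_inv, le_div_iff₀ (by positivity)]
    have h1 : ‖x‖ ≤ 1 + ‖x₀‖ := by
      have := norm_sub_norm_le x x₀
      rw [Metric.mem_ball, dist_eq_norm] at hx
      linarith
    have h2 : 1 + ‖w‖ ≤ (1 + ‖w - x‖) * (2 + ‖x₀‖) := by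
      have := norm_sub_norm_le w x
      nlinarith [norm_nonneg (w - x), norm_nonneg x₀]
    calc r * (1 + ‖w‖) ^ k ≤ r * ((1 + ‖w - x‖) * (2 + ‖x₀‖)) ^ k := by gcongr
      _ = ((1 + ‖w - x‖) ^ k * r) * (2 + ‖x₀‖) ^ k := by rw [mul_pow]; ring
      _ ≤ _ := by gcongr
  refine ⟨C₁ * (2 + ‖x₀‖) ^ k, by positivity, fun w x hx => ⟨?_, ?_⟩⟩
  · refine key w x hx _ (norm_nonneg _) ?_
    have := SchwartzMap.one_add_le_sup_seminorm_apply (𝕜 := ℝ) (m := (k, 1)) (k := k) (n := 0)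
      le_rfl (by simp) B (w - x)
    simpa using this
  · refine key w x hx _ (norm_nonneg _) ?_
    have := SchwartzMap.one_add_le_sup_seminorm_apply (𝕜 := ℝ) (m := (k, 1)) (k := k) (n := 1)
      le_rfl le_rfl B (w - x)
    rwa [norm_iteratedFDeriv_one] at this

lemma exists_norm_kernelDeriv_le (θ : ℝ) (hθ : 0 < θ) (B : 𝓢(Plane, ℂ)) (x₀ : Plane) :
    ∃ C : ℝ, 0 ≤ C ∧ ∀ w x : Plane, x ∈ Metric.ball x₀ 1 →
      ‖B (w - x)‖ ≤ C * ((1 + ‖w‖) ^ 2)⁻¹ ∧ ‖kernelDeriv θ B x w‖ ≤ C * ((1 + ‖w‖) ^ 2)⁻¹ := by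
  -- One power more than the target exponent 2: differentiating the phase costs a factor `‖w‖`.
  obtain ⟨C, hC, h⟩ := exists_norm_kernel_le B x₀ 3
  refine ⟨C * (1 + 4 / θ), by positivity, fun w x hx => ?_⟩
  obtain ⟨h1, h2⟩ := h w x hx
  have hw : ((1 + ‖w‖) ^ 3)⁻¹ * (1 + ‖w‖) = ((1 + ‖w‖) ^ 2)⁻¹ := by
    have : 1 + ‖w‖ ≠ 0 := by positivity
    field_simp
  have hw' : ((1 + ‖w‖) ^ 3)⁻¹ ≤ ((1 + ‖w‖) ^ 2)⁻¹ := by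
    rw [← hw]; exact le_mul_of_one_le_right (by positivity) (by simp)
  have hw'' : ((1 + ‖w‖) ^ 3)⁻¹ * ‖w‖ ≤ ((1 + ‖w‖) ^ 2)⁻¹ := by
    rw [← hw]; gcongr; linarith
  have hc : 0 ≤ C * (4 / θ) * ((1 + ‖w‖) ^ 2)⁻¹ := by positivity
  constructor
  · refine h1.trans ?_
    have : C * ((1 + ‖w‖) ^ 3)⁻¹ ≤ C * ((1 + ‖w‖) ^ 2)⁻¹ := by gcongr
    nlinarith
  · have h3 : ‖Complex.ofRealCLM.comp (twistCLM θ w)‖ ≤ 2 / θ * ‖w‖ := by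
      refine (ContinuousLinearMap.opNorm_comp_le _ _).trans ?_
      simpa using norm_twistCLM_le θ hθ w
    calc ‖kernelDeriv θ B x w‖
        ≤ ‖fderiv ℝ B (w - x)‖ + 2 * ‖B (w - x)‖ * ‖Complex.ofRealCLM.comp (twistCLM θ w)‖ := by
          rw [kernelDeriv, norm_smul, norm_phase, one_mul]
          refine (norm_add_le _ _).trans ?_
          rw [norm_neg, norm_smul]
          simp
      _ ≤ C * ((1 + ‖w‖) ^ 3)⁻¹ + 2 * (C * ((1 + ‖w‖) ^ 3)⁻¹) * (2 / θ * ‖w‖) := by gcongr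
      _ = C * ((1 + ‖w‖) ^ 3)⁻¹ + C * (4 / θ) * (((1 + ‖w‖) ^ 3)⁻¹ * ‖w‖) := by ring
      _ ≤ C * ((1 + ‖w‖) ^ 2)⁻¹ + C * (4 / θ) * ((1 + ‖w‖) ^ 2)⁻¹ := by gcongr
      _ = _ := by ring

/-- In dimension two `(1 + ‖w‖)⁻²` is square integrable, because `4 > 2`; Hölder pairs it with `b`.
-/
lemma integrable_inv_sq_mul_norm {E : Type*} [NormedAddCommGroup E] {b : Plane → E}
    (hb : MemLp b 2 volume) : Integrable fun w : Plane => ((1 + ‖w‖) ^ 2)⁻¹ * ‖b w‖ := by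
  have h : MemLp (fun w : Plane => ((1 + ‖w‖) ^ 2)⁻¹) 2 volume := by
    rw [memLp_two_iff_integrable_sq (by
      apply Measurable.aestronglyMeasurable; fun_prop)]
    have := integrable_one_add_norm (E := Plane) (μ := volume) (r := 4) (by simp; norm_num)
    refine this.congr (Filter.Eventually.of_forall fun w => ?_)
    have : (0 : ℝ) < 1 + ‖w‖ := by positivity
    simp only [inv_pow, ← pow_mul]
    rw [Real.rpow_neg this.le]
    norm_cast
  exact h.integrable_mul hb.norm

lemma continuous_phase_neg (θ : ℝ) (x : Plane) : Continuous (phase θ (-x)) := by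
  rw [funext (phase_neg_left θ x)]
  simp only [twist_eq]
  fun_prop

lemma continuous_kernelDeriv (θ : ℝ) (B : 𝓢(Plane, ℂ)) (x : Plane) :
    Continuous (kernelDeriv θ B x) := by
  have h1 : Continuous fun w => fderiv ℝ B (w - x) :=
    ((B.smooth 1).continuous_fderiv (by norm_num)).comp (by fun_prop)
  have h2 := continuous_phase_neg θ x
  have h3 := continuous_twistCLM θ
  have h4 := B.continuous
  unfold kernelDeriv
  fun_prop

lemma integrable_kernel_mul (θ : ℝ) (hθ : 0 < θ) (B : 𝓢(Plane, ℂ)) {b : Plane → ℂ}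
    (hb : MemLp b 2 volume) (x : Plane) :
    Integrable fun w => B (w - x) * phase θ (-x) w * b w := by
  obtain ⟨C, hC, h⟩ := exists_norm_kernelDeriv_le θ hθ B x
  refine ((integrable_inv_sq_mul_norm hb).const_mul C).mono' ?_
    (Filter.Eventually.of_forall fun w => ?_)
  · have h2 := continuous_phase_neg θ x
    have h4 := B.continuous
    exact (by fun_prop : Continuous fun w => B (w - x) * phase θ (-x) w).aestronglyMeasurable.mul
      hb.1
  · rw [norm_mul, norm_mul, norm_phase, mul_one, ← mul_assoc]
    gcongr
    exact (h w x (Metric.mem_ball_self one_pos)).1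

lemma integrable_kernelDeriv_smul (θ : ℝ) (hθ : 0 < θ) (B : 𝓢(Plane, ℂ)) {b : Plane → ℂ}
    (hb : MemLp b 2 volume) (x : Plane) :
    Integrable fun w => b w • kernelDeriv θ B x w := by
  obtain ⟨C, hC, h⟩ := exists_norm_kernelDeriv_le θ hθ B x
  refine ((integrable_inv_sq_mul_norm hb).const_mul C).mono' ?_
    (Filter.Eventually.of_forall fun w => ?_)
  · exact hb.1.smul (continuous_kernelDeriv θ B x).aestronglyMeasurable
  · rw [norm_smul, mul_comm, ← mul_assoc]
    gcongr
    exact (h w x (Metric.mem_ball_self one_pos)).2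

lemma hasFDerivAt_integral_kernel (θ : ℝ) (hθ : 0 < θ) (B : 𝓢(Plane, ℂ)) {b : Plane → ℂ}
    (hb : MemLp b 2 volume) (x : Plane) :
    HasFDerivAt (fun x => ∫ w, B (w - x) * phase θ (-x) w * b w)
      (∫ w, b w • kernelDeriv θ B x w) x := by
  obtain ⟨C, hC, h⟩ := exists_norm_kernelDeriv_le θ hθ B x
  refine hasFDerivAt_integral_of_dominated_of_fderiv_le (Metric.ball_mem_nhds x one_pos)
    (F' := fun x w => b w • kernelDeriv θ B x w)
    (bound := fun w => C * (((1 + ‖w‖) ^ 2)⁻¹ * ‖b w‖))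
    (Filter.Eventually.of_forall fun y => (integrable_kernel_mul θ hθ B hb y).1)
    (integrable_kernel_mul θ hθ B hb x) (integrable_kernelDeriv_smul θ hθ B hb x).1
    (Filter.Eventually.of_forall fun w y hy => ?_)
    ((integrable_inv_sq_mul_norm hb).const_mul C)
    (Filter.Eventually.of_forall fun w y _ => ?_)
  · rw [norm_smul, mul_comm, ← mul_assoc]
    gcongr
    exact (h w y hy).2
  · exact (hasFDerivAt_kernel θ B y w).mul_const (b w)

/-- The derivation property of `∂_v` for the Moyal product, in terms of the kernel: the commutator
of `∂_v` with the operator of left multiplication multiplies the kernel by `2 i v Θ⁻¹ z`. -/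
lemma fderiv_leftMul_sub {θ : ℝ} (hθ : 0 < θ) {a B : 𝓢(Plane, ℂ)}
    (hB : ∀ z, ∫ y, a y * phase θ y z = B z) {b : Plane → ℂ} (hd : Differentiable ℝ b)
    (hb : MemLp b 2 volume) (v : Plane) (hb' : MemLp (fun x => fderiv ℝ b x v) 2 volume)
    (x : Plane) :
    fderiv ℝ (leftMul θ a b) x v - leftMul θ a (fun x => fderiv ℝ b x v) x =
      (((Real.pi * θ) ^ 2)⁻¹ : ℝ) * ∫ z, 2 * Complex.I * (twist θ v z : ℂ) *
        (B z * phase θ (-x) z * b (x + z)) := by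
  have hfd : fderiv ℝ (leftMul θ a b) x v = (((Real.pi * θ) ^ 2)⁻¹ : ℝ) *
      ∫ w, b w * kernelDeriv θ B x w v := by
    have h := (hasFDerivAt_integral_kernel θ hθ B hb x).const_mul ((((Real.pi * θ) ^ 2)⁻¹ : ℝ) : ℂ)
    rw [funext (leftMul_eq_kernel hB b), h.fderiv, _root_.smul_apply,
      ContinuousLinearMap.integral_apply (integrable_kernelDeriv_smul θ hθ B hb x)]
    rfl
  set k : Plane → ℂ := fun w => B (w - x) * phase θ (-x) w with hk
  have hkd : ∀ w, HasFDerivAt k (phase θ (-x) w • (fderiv ℝ B (w - x) -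
      (2 * Complex.I * B (w - x)) • Complex.ofRealCLM.comp (twistCLM θ x))) w := by
    intro w
    have h1 : HasFDerivAt (fun w => B (w - x)) (fderiv ℝ B (w - x)) w := by
      have := (B.differentiableAt (x := w - x)).hasFDerivAt.comp w ((hasFDerivAt_id w).sub_const x)
      exact this.congr_fderiv (by ext; simp)
    have h3 : HasFDerivAt (fun w => ((twistCLM θ x w : ℝ) : ℂ))
      (Complex.ofRealCLM.comp (twistCLM θ x)) w :=
        (Complex.ofRealCLM.comp (twistCLM θ x)).hasFDerivAt
    have h2 := (h3.const_mul (-(2 * Complex.I))).cexp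
    have h4 : phase θ (-x) = fun w =>
        Complex.exp (-(2 * Complex.I) * ((twistCLM θ x w : ℝ) : ℂ)) := by
      ext w
      rw [phase_neg_left, twistCLM_apply, twist_swap]
      push_cast
      ring_nf
    rw [hk, h4]
    refine (h1.mul h2).congr_fderiv ?_
    ext u
    simp
    ring
  have hki : Integrable fun w => fderiv ℝ k w v * b w := by
    obtain ⟨C, hC, h⟩ := exists_norm_kernel_le B x 2
    refine ((integrable_inv_sq_mul_norm hb).const_mul
      (C * (‖v‖ + 2 * |twist θ v x|))).mono' ?_ (Filter.Eventually.of_forall fun w => ?_)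
    · refine AEStronglyMeasurable.mul ?_ hb.1
      simp only [fun w => (hkd w).fderiv]
      have h1 : Continuous fun w => fderiv ℝ B (w - x) :=
        ((B.smooth 1).continuous_fderiv (by norm_num)).comp (by fun_prop)
      have h2 := continuous_phase_neg θ x
      have h4 := B.continuous
      exact Continuous.aestronglyMeasurable (by fun_prop)
    · obtain ⟨h1, h2⟩ := h w x (Metric.mem_ball_self one_pos)
      rw [norm_mul, (hkd w).fderiv, ← mul_assoc]
      gcongr
      rw [_root_.smul_apply, norm_smul, norm_phase, one_mul]
      refine (norm_sub_le _ _).trans ?_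
      calc ‖fderiv ℝ B (w - x) v‖ + ‖((2 * Complex.I * B (w - x)) •
              Complex.ofRealCLM.comp (twistCLM θ x)) v‖
          ≤ ‖fderiv ℝ B (w - x)‖ * ‖v‖ + 2 * ‖B (w - x)‖ * |twist θ v x| := by
            gcongr
            · exact ContinuousLinearMap.le_opNorm _ _
            · simp [twistCLM_apply]
        _ ≤ C * ((1 + ‖w‖) ^ 2)⁻¹ * ‖v‖ + 2 * (C * ((1 + ‖w‖) ^ 2)⁻¹) * |twist θ v x| := by gcongr
        _ = _ := by ring
  -- Moving `∂_v` from `b` to the kernel leaves `∂_v` acting on `x` and `w` together. The factor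
  -- `B(w - x)` is invariant under this, and the phase gives `2 i (v Θ⁻¹ w - v Θ⁻¹ x)`.
  have hparts := integral_mul_fderiv_eq_neg_fderiv_mul_of_integrable (μ := volume) (v := v)
    hki (integrable_kernel_mul θ hθ B hb' x) (integrable_kernel_mul θ hθ B hb x)
    (fun w _ => (hkd w).differentiableAt) (fun w _ => hd w)
  have hi : Integrable fun w => b w * kernelDeriv θ B x w v :=
    (integrable_kernelDeriv_smul θ hθ B hb x).apply_continuousLinearMap v
  rw [hfd, leftMul_eq_kernel hB, hparts, ← mul_sub, sub_neg_eq_add, ← integral_add hi hki]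
  congr 1
  rw [← integral_add_left_eq_self _ x]
  congr 1
  ext z
  rw [(hkd _).fderiv, ← phase_sub_right_self θ x (x + z)]
  simp only [kernelDeriv, _root_.smul_apply, _root_.add_apply,
    _root_.neg_apply, _root_.sub_apply, ContinuousLinearMap.comp_apply,
    twistCLM_apply, Complex.ofRealCLM_apply, smul_eq_mul, add_sub_cancel_left]
  have : twist θ v (x + z) = twist θ v x + twist θ v z := by
    rw [twist_swap, twist_add_left, twist_swap θ x, twist_swap θ z]; ring
  rw [← phase_sub_right_self θ x (x + z), add_sub_cancel_left, this]
  push_cast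
  ring

/-! ### Gaussian integrals on the plane -/

/-- The complex coordinate `z = (x₁ + i x₂) / √2`. -/
noncomputable def zcoord (x : Plane) : ℂ :=
  ((x 0 : ℂ) + Complex.I * (x 1 : ℂ)) / (Real.sqrt 2 : ℂ)

/-- The coordinate `z̄` as a continuous real-linear map. -/
noncomputable def zbarCLM : Plane →L[ℝ] ℂ :=
  ((Real.sqrt 2 : ℂ)⁻¹ : ℂ) • (Complex.ofRealCLM.comp (EuclideanSpace.proj (𝕜 := ℝ) 0) -
    Complex.I • Complex.ofRealCLM.comp (EuclideanSpace.proj (𝕜 := ℝ) 1))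

/-- The coordinate `z` as a continuous real-linear map. -/
noncomputable def zcoordCLM : Plane →L[ℝ] ℂ :=
  ((Real.sqrt 2 : ℂ)⁻¹ : ℂ) • (Complex.ofRealCLM.comp (EuclideanSpace.proj (𝕜 := ℝ) 0) +
    Complex.I • Complex.ofRealCLM.comp (EuclideanSpace.proj (𝕜 := ℝ) 1))

lemma zbarCLM_apply (x : Plane) : zbarCLM x = zbar x := by
  simp [zbar, zbarCLM, div_eq_inv_mul]

lemma zcoordCLM_apply (x : Plane) : zcoordCLM x = zcoord x := by
  simp [zcoord, zcoordCLM, div_eq_inv_mul, mul_add]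

lemma hasFDerivAt_zbar (x : Plane) : HasFDerivAt zbar zbarCLM x := by
  rw [← funext zbarCLM_apply]; exact zbarCLM.hasFDerivAt

lemma hasFDerivAt_zcoord (x : Plane) : HasFDerivAt zcoord zcoordCLM x := by
  rw [← funext zcoordCLM_apply]; exact zcoordCLM.hasFDerivAt

lemma sqrt_two_sq : (Real.sqrt 2 : ℂ) ^ 2 = 2 := by
  norm_cast; simp

lemma conj_zbar (x : Plane) : (starRingEnd ℂ) (zbar x) = zcoord x := by
  simp [zbar, zcoord]

lemma zbar_add (x y : Plane) : zbar (x + y) = zbar x + zbar y := by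
  simp only [← zbarCLM_apply, map_add]

/-- The Wirtinger derivative `∂ = (∂₁ - i ∂₂) / √2`. -/
noncomputable def dz (f : Plane → ℂ) (x : Plane) : ℂ :=
  (Real.sqrt 2 : ℂ)⁻¹ * (fderiv ℝ f x (e 0) - Complex.I * fderiv ℝ f x (e 1))

lemma HasFDerivAt.dz_eq {f : Plane → ℂ} {f' : Plane →L[ℝ] ℂ} {x : Plane}
    (h : HasFDerivAt f f' x) :
    dz f x = (Real.sqrt 2 : ℂ)⁻¹ * (f' (e 0) - Complex.I * f' (e 1)) := by
  rw [dz, h.fderiv]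

lemma zbarCLM_e_zero : zbarCLM (e 0) = (Real.sqrt 2 : ℂ)⁻¹ := by
  simp [zbarCLM, e]

lemma zbarCLM_e_one : zbarCLM (e 1) = -(Complex.I * (Real.sqrt 2 : ℂ)⁻¹) := by
  simp [zbarCLM, e]; ring

lemma zcoordCLM_e_zero : zcoordCLM (e 0) = (Real.sqrt 2 : ℂ)⁻¹ := by
  simp [zcoordCLM, e]

lemma zcoordCLM_e_one : zcoordCLM (e 1) = Complex.I * (Real.sqrt 2 : ℂ)⁻¹ := by
  simp [zcoordCLM, e]; ring

/-- The Gaussian `exp (-c |x|²)`, as a complex valued function. -/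
noncomputable def gaussian (c : ℝ) (x : Plane) : ℂ := (Real.exp (-(c * ‖x‖ ^ 2)) : ℝ)

lemma f00_eq_gaussian (θ : ℝ) (hθ : 0 < θ) (x : Plane) : f00 θ hθ x = 2 * gaussian θ⁻¹ x := by
  rw [f00_apply, gaussian, ham_eq]
  congr 3
  field_simp

lemma hasFDerivAt_gaussian (c : ℝ) (x : Plane) :
    HasFDerivAt (gaussian c)
      ((-(2 * c) * gaussian c x) • Complex.ofRealCLM.comp (innerSL ℝ x)) x := by
  have h := (((hasStrictFDerivAt_norm_sq x).hasFDerivAt.const_mul c).neg.exp)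
  have h2 := Complex.ofRealCLM.hasFDerivAt.comp x h
  refine (h2.congr_fderiv ?_)
  ext v
  simp [gaussian]
  ring

lemma inner_e (x : Plane) (μ : Fin 2) : inner ℝ x (e μ) = x μ := by
  simp [e, EuclideanSpace.inner_single_right]

/-- Continuous functions of at most exponential growth. -/
def ExpGrowth (f : Plane → ℂ) : Prop :=
  Continuous f ∧ ∃ C c : ℝ, 0 ≤ C ∧ ∀ x, ‖f x‖ ≤ C * Real.exp (c * ‖x‖)

namespace ExpGrowth

variable {f g : Plane → ℂ}

lemma const (a : ℂ) : ExpGrowth fun _ => a :=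
  ⟨continuous_const, ‖a‖, 0, norm_nonneg _, fun x => by simp⟩

lemma mul (hf : ExpGrowth f) (hg : ExpGrowth g) : ExpGrowth fun x => f x * g x := by
  obtain ⟨hf, C, c, hC, h⟩ := hf
  obtain ⟨hg, D, d, hD, k⟩ := hg
  refine ⟨hf.mul hg, C * D, c + d, by positivity, fun x => ?_⟩
  calc ‖f x * g x‖ ≤ (C * Real.exp (c * ‖x‖)) * (D * Real.exp (d * ‖x‖)) := by
        rw [norm_mul]; gcongr
        · exact h x
        · exact k x
    _ = _ := by rw [add_mul, Real.exp_add]; ring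

lemma add (hf : ExpGrowth f) (hg : ExpGrowth g) : ExpGrowth fun x => f x + g x := by
  obtain ⟨hf, C, c, hC, h⟩ := hf
  obtain ⟨hg, D, d, hD, k⟩ := hg
  refine ⟨hf.add hg, C + D, max c d, by positivity, fun x => (norm_add_le _ _).trans ?_⟩
  rw [add_mul]
  refine add_le_add ((h x).trans ?_) ((k x).trans ?_)
  · gcongr; exact le_max_left _ _
  · gcongr; exact le_max_right _ _

lemma pow (hf : ExpGrowth f) (n : ℕ) : ExpGrowth fun x => f x ^ n := by
  induction n with
  | zero => simpa using const 1
  | succ n ih => simpa only [pow_succ] using ih.mul hf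

lemma clm (L : Plane →L[ℝ] ℂ) : ExpGrowth L := by
  refine ⟨L.continuous, ‖L‖, 1, norm_nonneg _, fun x => (L.le_opNorm x).trans ?_⟩
  gcongr
  rw [one_mul]
  linarith [Real.add_one_le_exp ‖x‖]

lemma cexp_clm (L : Plane →L[ℝ] ℂ) : ExpGrowth fun x => Complex.exp (L x) := by
  refine ⟨by fun_prop, 1, ‖L‖, zero_le_one, fun x => ?_⟩
  rw [one_mul, Complex.norm_exp]
  gcongr
  exact (Complex.re_le_norm _).trans (L.le_opNorm x)

lemma zbar : ExpGrowth zbar := by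
  rw [← funext zbarCLM_apply]; exact clm _

lemma zcoord : ExpGrowth zcoord := by
  rw [← funext zcoordCLM_apply]; exact clm _

lemma integrable (hf : ExpGrowth f) {l : ℝ} (hl : 0 < l) :
    Integrable fun x => gaussian l x * f x := by
  obtain ⟨hf, C, c, hC, h⟩ := hf
  have hg : Integrable fun x : Plane => Real.exp (-(l / 2) * ‖x‖ ^ 2) := by
    have := GaussianFourier.integrable_cexp_neg_mul_sq_norm_add (V := Plane) (b := (l / 2 : ℝ))
      (by simpa using hl) 0 0
    have := this.norm
    simpa [Complex.norm_exp, ← Complex.ofReal_pow] using this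
  refine (hg.const_mul (C * Real.exp (c ^ 2 / (2 * l)))).mono' ?_
    (Filter.Eventually.of_forall fun x => ?_)
  · have : Continuous (gaussian l) :=
      continuous_iff_continuousAt.2 fun x => (hasFDerivAt_gaussian l x).continuousAt
    exact (this.mul hf).aestronglyMeasurable
  · rw [norm_mul, gaussian, Complex.norm_real, Real.norm_of_nonneg (Real.exp_pos _).le]
    calc Real.exp (-(l * ‖x‖ ^ 2)) * ‖f x‖
        ≤ Real.exp (-(l * ‖x‖ ^ 2)) * (C * Real.exp (c * ‖x‖)) := by gcongr; exact h x
      _ = C * Real.exp (-(l * ‖x‖ ^ 2) + c * ‖x‖) := by rw [Real.exp_add]; ring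
      _ ≤ C * Real.exp (c ^ 2 / (2 * l) + -(l / 2) * ‖x‖ ^ 2) := by
        refine mul_le_mul_of_nonneg_left (Real.exp_le_exp.2 ?_) hC
        -- Completing the square: half of the Gaussian absorbs the exponential growth.
        have : c ^ 2 / (2 * l) + -(l / 2) * ‖x‖ ^ 2 - (-(l * ‖x‖ ^ 2) + c * ‖x‖) =
            (c - l * ‖x‖) ^ 2 / (2 * l) := by field_simp; ring
        have h2 : 0 ≤ (c - l * ‖x‖) ^ 2 / (2 * l) := by positivity
        linarith
      _ = _ := by rw [Real.exp_add]; ring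

end ExpGrowth

lemma integral_gaussian_mul_coord {l : ℝ} (hl : 0 < l) {f : Plane → ℂ} (hd : Differentiable ℝ f)
    (hf : ExpGrowth f) (μ : Fin 2) (hf' : ExpGrowth fun x => fderiv ℝ f x (e μ)) :
    ∫ x, gaussian l x * ((2 * l * x μ : ℂ) * f x) = ∫ x, gaussian l x * fderiv ℝ f x (e μ) := by
  have hv : ∀ x : Plane, fderiv ℝ (gaussian l) x (e μ) * f x =
      -(gaussian l x * ((2 * l * x μ : ℂ) * f x)) := by
    intro x
    rw [(hasFDerivAt_gaussian l x).fderiv]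
    simp [inner_e]
    ring
  have hc : ExpGrowth fun x : Plane => (2 * l * x μ : ℂ) * f x := by
    refine (ExpGrowth.mul (ExpGrowth.const (2 * l)) ?_).mul hf
    exact ExpGrowth.clm (Complex.ofRealCLM.comp (EuclideanSpace.proj (𝕜 := ℝ) μ))
  rw [integral_mul_fderiv_eq_neg_fderiv_mul_of_integrable _ (hf'.integrable hl)
    (hf.integrable hl) (fun x _ => (hasFDerivAt_gaussian l x).differentiableAt) (fun x _ => hd x)]
  · simp_rw [hv]
    rw [integral_neg, neg_neg]
  · simp_rw [hv]
    exact (hc.integrable hl).neg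

/-- Integration by parts in complex form: under a Gaussian, `z̄` acts as `(2l)⁻¹ ∂`. Since `∂ z = 1`
and `∂ z̄ = 0`, this removes powers of `z̄` one at a time. -/
lemma integral_gaussian_mul_zbar_mul {l : ℝ} (hl : 0 < l) {f : Plane → ℂ}
    (hd : Differentiable ℝ f) (hf : ExpGrowth f)
    (hf' : ∀ μ, ExpGrowth fun x => fderiv ℝ f x (e μ)) :
    ∫ x, gaussian l x * (zbar x * f x) = (2 * l : ℂ)⁻¹ * ∫ x, gaussian l x * dz f x := by
  have hl' : (l : ℂ) ≠ 0 := by exact_mod_cast hl.ne'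
  have hc : ∀ μ, Integrable fun x : Plane => gaussian l x * ((2 * l * x μ : ℂ) * f x) := by
    intro μ
    refine ((ExpGrowth.mul (ExpGrowth.const (2 * l)) ?_).mul hf).integrable hl
    exact ExpGrowth.clm (Complex.ofRealCLM.comp (EuclideanSpace.proj (𝕜 := ℝ) μ))
  have h1 : ∀ x, gaussian l x * (zbar x * f x) = (2 * l : ℂ)⁻¹ * (Real.sqrt 2 : ℂ)⁻¹ *
      (gaussian l x * ((2 * l * x 0 : ℂ) * f x) -
        Complex.I * (gaussian l x * ((2 * l * x 1 : ℂ) * f x))) := by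
    intro x
    rw [zbar]
    field_simp
  have h2 : ∀ x, gaussian l x * dz f x = (Real.sqrt 2 : ℂ)⁻¹ *
      (gaussian l x * fderiv ℝ f x (e 0) - Complex.I * (gaussian l x * fderiv ℝ f x (e 1))) := by
    intro x; rw [dz]; ring
  simp_rw [h1, h2]
  rw [integral_const_mul, integral_const_mul, integral_sub (hc 0) ((hc 1).const_mul _),
    integral_sub ((hf' 0).integrable hl) (((hf' 1).integrable hl).const_mul _),
    integral_const_mul, integral_const_mul, integral_gaussian_mul_coord hl hd hf 0 (hf' 0),
    integral_gaussian_mul_coord hl hd hf 1 (hf' 1)]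
  ring

/-- The exponential is holomorphic in `z`, so its Gaussian mean is its value at the origin;
concretely, the frequency vector `(β, iβ)/√2` is isotropic. -/
lemma integral_gaussian_mul_cexp_zcoord {l : ℝ} (hl : 0 < l) (β : ℂ) :
    ∫ x, gaussian l x * Complex.exp (β * zcoord x) = Real.pi / l := by
  have h := GaussianFourier.integral_cexp_neg_mul_sum_add (ι := Fin 2) (b := (l : ℂ))
    (by simpa using hl) ![β / Real.sqrt 2, Complex.I * β / Real.sqrt 2]
  rw [← (PiLp.volume_preserving_toLp (Fin 2)).integral_comp
    (MeasurableEquiv.toLp 2 _).measurableEmbedding]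
  have hs : ∑ i, (![β / Real.sqrt 2, Complex.I * β / Real.sqrt 2] : Fin 2 → ℂ) i ^ 2 = 0 := by
    simp [Fin.sum_univ_two, div_pow, mul_pow]
    ring
  rw [hs] at h
  have e1 : ((Fintype.card (Fin 2) : ℂ) / 2) = 1 := by simp
  rw [e1, Complex.cpow_one, zero_div, Complex.exp_zero, mul_one] at h
  rw [← h]
  congr 1
  ext v
  simp only [gaussian, zcoord, Fin.sum_univ_two, EuclideanSpace.norm_sq_eq, Complex.ofReal_exp,
    ← Complex.exp_add]
  congr 1
  simp
  ring

/-- Each factor `z̄` turns into `∂`, which ignores `(w + z̄)^m` and multiplies `exp (β z)` by `β`;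
so `z̄` is effectively replaced by `β/(2l)`. -/
lemma integral_gaussian_mul_pow_mul_cexp {l : ℝ} (hl : 0 < l) (w β : ℂ) (m : ℕ) :
    ∫ x, gaussian l x * ((w + zbar x) ^ m * Complex.exp (β * zcoord x)) =
      (w + β / (2 * l)) ^ m * (Real.pi / l) := by
  have hl' : (l : ℂ) ≠ 0 := by exact_mod_cast hl.ne'
  have gexp : ExpGrowth fun x => Complex.exp (β * zcoord x) := by
    have := ExpGrowth.cexp_clm (β • zcoordCLM)
    simpa [zcoordCLM_apply] using this
  have gp : ∀ m : ℕ, ExpGrowth fun x => (w + zbar x) ^ m :=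
    fun m => ((ExpGrowth.const w).add ExpGrowth.zbar).pow m
  induction m with
  | zero => simp [integral_gaussian_mul_cexp_zcoord hl]
  | succ m ih =>
    have hd : ∀ x, HasFDerivAt (fun x => (w + zbar x) ^ m * Complex.exp (β * zcoord x))
        ((w + zbar x) ^ m • (Complex.exp (β * zcoord x) • β • zcoordCLM) +
          Complex.exp (β * zcoord x) • (((m : ℂ) * (w + zbar x) ^ (m - 1)) • zbarCLM)) x := by
      intro x
      have h1 := ((hasFDerivAt_zbar x).const_add w).pow m
      have h2 := ((hasFDerivAt_zcoord x).const_mul β).cexp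
      refine (h1.mul h2).congr_fderiv ?_
      ext v
      simp
    have hdz : ∀ x, dz (fun x => (w + zbar x) ^ m * Complex.exp (β * zcoord x)) x =
        β * ((w + zbar x) ^ m * Complex.exp (β * zcoord x)) := by
      intro x
      rw [HasFDerivAt.dz_eq (hd x)]
      simp [zbarCLM_e_zero, zbarCLM_e_one, zcoordCLM_e_zero, zcoordCLM_e_one]
      have := sqrt_two_sq
      have h0 : (Real.sqrt 2 : ℂ) ≠ 0 := by simp
      have hI := Complex.I_sq
      field_simp
      rw [this, hI]
      ring
    have key := integral_gaussian_mul_zbar_mul hl (fun x => (hd x).differentiableAt)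
      ((gp m).mul gexp) (fun μ => by
        simp only [fun x => (hd x).fderiv]
        have := ((gp m).mul (gexp.mul (ExpGrowth.const (β * zcoordCLM (e μ))))).add
          (gexp.mul (((ExpGrowth.const (m : ℂ)).mul (gp (m - 1))).mul
            (ExpGrowth.const (zbarCLM (e μ)))))
        simpa using this)
    simp_rw [hdz] at key
    have hsplit : ∀ x, gaussian l x * ((w + zbar x) ^ (m + 1) * Complex.exp (β * zcoord x)) =
        w * (gaussian l x * ((w + zbar x) ^ m * Complex.exp (β * zcoord x))) +
        gaussian l x * (zbar x * ((w + zbar x) ^ m * Complex.exp (β * zcoord x))) := by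
      intro x; ring
    simp_rw [hsplit]
    rw [integral_add ((((gp m).mul gexp).integrable hl).const_mul _)
      ((ExpGrowth.zbar.mul ((gp m).mul gexp)).integrable hl), key, integral_const_mul]
    simp_rw [mul_left_comm _ β]
    rw [integral_const_mul, ih, pow_succ]
    field_simp

lemma integral_gaussian_mul_zbar_pow_mul_zcoord_pow {l : ℝ} (hl : 0 < l) (n m : ℕ) :
    ∫ x, gaussian l x * (zbar x ^ n * zcoord x ^ m) =
      if n = m then (n.factorial : ℂ) / (2 * l) ^ n * (Real.pi / l) else 0 := by
  have hl' : (l : ℂ) ≠ 0 := by exact_mod_cast hl.ne'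
  have succ : ∀ n m : ℕ, ∫ x, gaussian l x * (zbar x ^ (n + 1) * zcoord x ^ m) =
      m / (2 * l) * ∫ x, gaussian l x * (zbar x ^ n * zcoord x ^ (m - 1)) := by
    intro n m
    have hd : ∀ x, HasFDerivAt (fun x => zbar x ^ n * zcoord x ^ m)
        (zbar x ^ n • (((m : ℂ) * zcoord x ^ (m - 1)) • zcoordCLM) +
          zcoord x ^ m • (((n : ℂ) * zbar x ^ (n - 1)) • zbarCLM)) x := by
      intro x
      refine (((hasFDerivAt_zbar x).pow n).mul ((hasFDerivAt_zcoord x).pow m)).congr_fderiv ?_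
      ext v
      simp
    have hdz : ∀ x, dz (fun x => zbar x ^ n * zcoord x ^ m) x =
        m * (zbar x ^ n * zcoord x ^ (m - 1)) := by
      intro x
      rw [HasFDerivAt.dz_eq (hd x)]
      simp [zbarCLM_e_zero, zbarCLM_e_one, zcoordCLM_e_zero, zcoordCLM_e_one]
      have := sqrt_two_sq
      have h0 : (Real.sqrt 2 : ℂ) ≠ 0 := by simp
      have hI := Complex.I_sq
      field_simp
      rw [this, hI]
      ring
    have key := integral_gaussian_mul_zbar_mul hl (fun x => (hd x).differentiableAt)
      ((ExpGrowth.zbar.pow n).mul (ExpGrowth.zcoord.pow m)) (fun μ => by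
        simp only [fun x => (hd x).fderiv]
        have := ((ExpGrowth.zbar.pow n).mul (((ExpGrowth.const (m : ℂ)).mul
          (ExpGrowth.zcoord.pow (m - 1))).mul (ExpGrowth.const (zcoordCLM (e μ))))).add
          ((ExpGrowth.zcoord.pow m).mul (((ExpGrowth.const (n : ℂ)).mul
            (ExpGrowth.zbar.pow (n - 1))).mul (ExpGrowth.const (zbarCLM (e μ)))))
        simpa using this)
    simp_rw [hdz, mul_left_comm _ (m : ℂ)] at key
    rw [integral_const_mul] at key
    simp_rw [pow_succ', mul_assoc, key]
    ring
  -- With no `z̄` left to trade, conjugation exchanges the exponents; the recursion at `m = 0` then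
  -- has the factor `0` in front, which also makes the truncated `m - 1` harmless.
  have zero : ∀ m : ℕ, ∫ x, gaussian l x * (zbar x ^ 0 * zcoord x ^ (m + 1)) = 0 := by
    intro m
    have h := succ m 0
    rw [Nat.cast_zero, zero_div, zero_mul] at h
    have h2 := integral_conj (μ := (volume : Measure Plane))
      (f := fun x => gaussian l x * (zbar x ^ (m + 1) * zcoord x ^ 0))
    rw [h, map_zero] at h2
    rw [← h2]
    congr 1
    ext x
    rw [gaussian]
    simp only [map_mul, map_pow, conj_zbar, Complex.conj_ofReal]
    simp
  induction n generalizing m with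
  | zero =>
    cases m with
    | zero => simpa using integral_gaussian_mul_cexp_zcoord hl 0
    | succ m => rw [zero]; simp
  | succ n ih =>
    rw [succ]
    cases m with
    | zero => simp
    | succ m =>
      rw [Nat.add_sub_cancel, ih]
      by_cases h : n = m
      · subst h
        simp [Nat.factorial_succ]
        field_simp
        ring
      · simp [h]

/-! ### The matrix base and the action of Gaussians on it -/

/-- `∂` kills `z̄^m` and sends `exp (-|x|²/θ)` to `-(2/θ) z̄` times itself, so each application of
`z̄ - (θ/2) ∂` multiplies by `2 z̄`. -/
lemma zbarStar_iterate_apply (θ : ℝ) (hθ : 0 < θ) (m : ℕ) (x : Plane) :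
    (zbarStar θ)^[m] (f00 θ hθ) x = 2 ^ m * zbar x ^ m * (2 * gaussian θ⁻¹ x) := by
  induction m generalizing x with
  | zero => simp [f00_eq_gaussian]
  | succ m ih =>
    rw [Function.iterate_succ_apply']
    set g := (zbarStar θ)^[m] (f00 θ hθ)
    have hg : (g : Plane → ℂ) = fun x => (2 ^ (m + 1) * zbar x ^ m) * gaussian θ⁻¹ x := by
      ext x; rw [ih]; ring
    have hd := (((hasFDerivAt_zbar x).pow m).const_mul (2 ^ (m + 1) : ℂ)).mul
      (hasFDerivAt_gaussian θ⁻¹ x)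
    have h1 : zbarStar θ g x = zbar x * g x - (θ / 2 : ℝ) * dz g x := by
      simp [zbarStar, smulLeftCLM_apply_apply zbar_temperate, dz, lineDerivOp_apply_eq_fderiv]
    have hd' := hd.congr_of_eventuallyEq (f₁ := g)
      (Filter.Eventually.of_forall fun y => congrFun hg y)
    rw [h1, HasFDerivAt.dz_eq hd', hg]
    have hθ' : (θ : ℂ) ≠ 0 := by exact_mod_cast hθ.ne'
    have h0 : (Real.sqrt 2 : ℂ) ≠ 0 := by simp
    have hI := Complex.I_sq
    have h2 := sqrt_two_sq
    simp [zbarCLM_e_zero, zbarCLM_e_one, inner_e]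
    have h3 : (x 0 : ℂ) = Real.sqrt 2 * zbar x + Complex.I * x 1 := by
      rw [zbar]; field_simp; ring
    rw [h3]
    field_simp
    linear_combination (-(gaussian (1 / θ) x * θ * m * zbar x ^ (m - 1))) * hI

/-- The constant `2^(m+1) / √(θ^m m!)` of `f_{m0}`. -/
noncomputable def basisConst (θ : ℝ) (m : ℕ) : ℝ :=
  (Real.sqrt (θ ^ m * m.factorial))⁻¹ * 2 ^ (m + 1)

lemma basisFun_apply (θ : ℝ) (hθ : 0 < θ) (m : ℕ) (x : Plane) :
    basisFun θ hθ m x = (basisConst θ m : ℂ) * (zbar x ^ m * gaussian θ⁻¹ x) := by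
  rw [basisFun, _root_.smul_apply, zbarStar_iterate_apply, basisConst, smul_eq_mul]
  push_cast
  ring

/-- The twist is the inner product of `y` with `θ⁻¹(-z₂, z₁)`, so this is the Fourier transform of a
Gaussian: width `τ` becomes `θ²/τ`. -/
lemma integral_f00_mul_phase (θ τ : ℝ) (hθ : 0 < θ) (hτ : 0 < τ) (z : Plane) :
    ∫ y, f00 τ hτ y * phase θ y z = (Real.pi * τ : ℝ) * (2 * gaussian (τ / θ ^ 2) z) := by
  have h := GaussianFourier.integral_cexp_neg_mul_sq_norm_add (V := Plane) (b := (τ⁻¹ : ℝ))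
    (by simpa using hτ) (-(2 * Complex.I)) (θ⁻¹ • !₂[-z 1, z 0])
  have hn : ‖(θ⁻¹ • !₂[-z 1, z 0] : Plane)‖ ^ 2 = ‖z‖ ^ 2 / θ ^ 2 := by
    simp [EuclideanSpace.norm_sq_eq, Fin.sum_univ_two]
    field_simp
    simp only [sq_abs]
    ring
  have hi : ∀ y : Plane, inner ℝ (θ⁻¹ • !₂[-z 1, z 0] : Plane) y = twist θ y z := by
    intro y
    simp [PiLp.inner_apply, Fin.sum_univ_two, twist_eq]
    ring
  simp only [hi] at h
  have h1 : ∀ y, f00 τ hτ y * phase θ y z =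
      2 * Complex.exp (-((τ⁻¹ : ℝ) : ℂ) * (‖y‖ : ℂ) ^ 2 +
        -(2 * Complex.I) * (twist θ y z : ℂ)) := by
    intro y
    rw [f00_eq_gaussian, gaussian, phase, Complex.exp_add]
    push_cast
    ring_nf
  simp_rw [h1]
  rw [integral_const_mul, h, finrank_euclideanSpace_fin]
  have h2 : ((2 : ℕ) : ℂ) / 2 = 1 := by norm_num
  rw [h2, Complex.cpow_one, gaussian, ← Complex.ofReal_pow, hn]
  have hτ' : (τ : ℂ) ≠ 0 := by exact_mod_cast hτ.ne'
  have hθ' : (θ : ℂ) ≠ 0 := by exact_mod_cast hθ.ne'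
  push_cast
  have h3 : (-(2 * Complex.I)) ^ 2 * ((‖z‖ : ℂ) ^ 2 / (θ : ℂ) ^ 2) / (4 * (τ : ℂ)⁻¹) =
      -((τ : ℂ) / (θ : ℂ) ^ 2 * (‖z‖ : ℂ) ^ 2) := by
    rw [neg_sq, mul_pow, Complex.I_sq]
    field_simp
    norm_num
    ring
  rw [h3]
  field_simp

/-- The transform `∫ a(y) exp (-2 i y Θ⁻¹ z) dy` of the Gaussian `r f₀₀` of width `τ`. -/
noncomputable def gaussHat (θ τ : ℝ) (hθ : 0 < θ) (hτ : 0 < τ) (r : ℝ) : 𝓢(Plane, ℂ) :=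
  ((r * (Real.pi * τ) : ℝ) : ℂ) • f00 (θ ^ 2 / τ) (by positivity)

lemma gaussHat_apply (θ τ : ℝ) (hθ : 0 < θ) (hτ : 0 < τ) (r : ℝ) (z : Plane) :
    gaussHat θ τ hθ hτ r z = (2 * r * (Real.pi * τ) : ℝ) * gaussian (τ / θ ^ 2) z := by
  rw [gaussHat, _root_.smul_apply, f00_eq_gaussian, inv_div, smul_eq_mul]
  push_cast
  ring

lemma integral_smul_f00_mul_phase (θ τ : ℝ) (hθ : 0 < θ) (hτ : 0 < τ) (r : ℝ) (z : Plane) :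
    ∫ y, ((r : ℂ) • f00 τ hτ) y * phase θ y z = gaussHat θ τ hθ hτ r z := by
  simp_rw [_root_.smul_apply, smul_eq_mul, mul_assoc]
  rw [integral_const_mul, integral_f00_mul_phase θ τ hθ hτ, gaussHat_apply]
  push_cast
  ring

/-- The cross term `-2 x·z/θ` and the phase combine into a product of `z̄(x)` with the holomorphic
coordinate of `z`, which makes the Gaussian integral below exact. -/
lemma gaussian_add_mul_phase {θ : ℝ} (hθ : 0 < θ) (x z : Plane) :
    phase θ (-x) z * gaussian θ⁻¹ (x + z) =
      gaussian θ⁻¹ x * gaussian θ⁻¹ z * Complex.exp (-(4 / θ * zbar x) * zcoord z) := by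
  have hθ' : (θ : ℂ) ≠ 0 := by exact_mod_cast hθ.ne'
  simp only [phase_neg_left, gaussian, twist_eq, EuclideanSpace.norm_sq_eq, Fin.sum_univ_two,
    Complex.ofReal_exp, ← Complex.exp_add, zbar, zcoord]
  congr 1
  have h0 : (Real.sqrt 2 : ℂ) ≠ 0 := by simp
  have hI := Complex.I_sq
  have h2 := sqrt_two_sq
  simp
  field_simp
  rw [h2]
  ring_nf
  rw [hI]
  ring

/-- The functions `f_{m0}` are eigenvectors for the Moyal multiplication with a Gaussian. -/
lemma leftMul_f00_basisFun (θ τ : ℝ) (hθ : 0 < θ) (hτ : 0 < τ) (r : ℝ) (m : ℕ) (x : Plane) :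
    leftMul θ ((r : ℂ) • f00 τ hτ) (basisFun θ hθ m) x =
      (r * (2 * τ / (τ + θ)) * ((τ - θ) / (τ + θ)) ^ m : ℝ) * basisFun θ hθ m x := by
  rw [leftMul_eq_twistedConv (integral_smul_f00_mul_phase θ τ hθ hτ r)]
  have hl : 0 < (τ + θ) / θ ^ 2 := by positivity
  have h1 : ∀ z, gaussHat θ τ hθ hτ r z * phase θ (-x) z * basisFun θ hθ m (x + z) =
      ((2 * r * (Real.pi * τ) : ℝ) * basisConst θ m * gaussian θ⁻¹ x) *
        (gaussian ((τ + θ) / θ ^ 2) z *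
          ((zbar x + zbar z) ^ m * Complex.exp (-(4 / θ * zbar x) * zcoord z))) := by
    intro z
    have hg : gaussian ((τ + θ) / θ ^ 2) z = gaussian (τ / θ ^ 2) z * gaussian θ⁻¹ z := by
      simp only [gaussian, ← Complex.ofReal_mul, ← Real.exp_add]
      congr 2
      field_simp
      ring
    rw [basisFun_apply, gaussHat_apply, zbar_add, hg]
    linear_combination ((2 * r * (Real.pi * τ) : ℝ) * basisConst θ m * gaussian (τ / θ ^ 2) z *
      (zbar x + zbar z) ^ m) * gaussian_add_mul_phase hθ x z
  simp_rw [h1]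
  rw [integral_const_mul, integral_gaussian_mul_pow_mul_cexp hl, basisFun_apply]
  have hτ' : (τ : ℂ) ≠ 0 := by exact_mod_cast hτ.ne'
  have hθ' : (θ : ℂ) ≠ 0 := by exact_mod_cast hθ.ne'
  have hs : (τ : ℂ) + θ ≠ 0 := by exact_mod_cast (by positivity : τ + θ ≠ 0)
  have hpi : (Real.pi : ℂ) ≠ 0 := by exact_mod_cast Real.pi_ne_zero
  -- This is `w + β/(2l)` with `w = z̄(x)`, `β = -(4/θ) z̄(x)` and `l = (τ+θ)/θ²`; it yields the
  -- ratio `q` of successive eigenvalues.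
  have h2 : zbar x + -(4 / θ * zbar x) / (2 * ((τ + θ) / θ ^ 2 : ℝ)) =
      ((τ : ℂ) - θ) / (τ + θ) * zbar x := by
    push_cast
    field_simp
    ring
  rw [h2, mul_pow (((τ : ℂ) - θ) / (τ + θ)) (zbar x) m]
  push_cast
  generalize (((τ : ℂ) - θ) / (τ + θ)) ^ m = q
  field_simp

/-- The orthonormal family `(2πθ)^{-1/2} f_{m0}`. -/
noncomputable def basisVec (θ : ℝ) (hθ : 0 < θ) (m : ℕ) : Lp ℂ 2 (volume : Measure Plane) :=
  ((1 / Real.sqrt (2 * Real.pi * θ) : ℝ) : ℂ) • (basisFun θ hθ m).toLp 2 volume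

lemma inner_toLp_basisFun (θ : ℝ) (hθ : 0 < θ) (m n : ℕ) :
    inner ℂ ((basisFun θ hθ m).toLp 2 volume) ((basisFun θ hθ n).toLp 2 volume) =
      if m = n then (2 * Real.pi * θ : ℂ) else 0 := by
  rw [L2.inner_def]
  have h1 : ∀ᵐ x, inner ℂ ((basisFun θ hθ m).toLp 2 volume x) ((basisFun θ hθ n).toLp 2 volume x) =
      ((basisConst θ m : ℂ) * basisConst θ n) *
        (gaussian (2 / θ) x * (zbar x ^ n * zcoord x ^ m)) := by
    filter_upwards [(basisFun θ hθ m).coeFn_toLp 2 volume,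
      (basisFun θ hθ n).coeFn_toLp 2 volume] with x hm hn
    have hg : gaussian (2 / θ) x = gaussian θ⁻¹ x * gaussian θ⁻¹ x := by
      simp only [gaussian, ← Complex.ofReal_mul, ← Real.exp_add]
      congr 2
      field_simp
      ring
    have hc : (starRingEnd ℂ) (gaussian θ⁻¹ x) = gaussian θ⁻¹ x := Complex.conj_ofReal _
    rw [hm, hn, basisFun_apply, basisFun_apply, RCLike.inner_apply, hg]
    simp only [map_mul, map_pow, conj_zbar, hc, Complex.conj_ofReal]
    ring
  rw [integral_congr_ae h1, integral_const_mul,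
    integral_gaussian_mul_zbar_pow_mul_zcoord_pow (by positivity)]
  by_cases h : m = n
  · subst h
    rw [if_pos rfl, if_pos rfl]
    have hs : (basisConst θ m) * basisConst θ m = 4 ^ (m + 1) / (θ ^ m * m.factorial) := by
      have := Real.mul_self_sqrt (show 0 ≤ θ ^ m * m.factorial by positivity)
      rw [basisConst, mul_mul_mul_comm, ← mul_inv, this, ← mul_pow]
      norm_num
      field_simp
    rw [← Complex.ofReal_mul, hs]
    have hθ' : (θ : ℂ) ≠ 0 := by exact_mod_cast hθ.ne'
    have hf : (m.factorial : ℂ) ≠ 0 := by exact_mod_cast m.factorial_ne_zero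
    have h4 : (2 * ((2 : ℂ) / θ)) ^ m = 4 ^ m / θ ^ m := by rw [← div_pow]; ring
    push_cast
    rw [h4]
    field_simp
    ring
  · rw [if_neg h, if_neg (Ne.symm h), mul_zero]

lemma orthonormal_basisVec (θ : ℝ) (hθ : 0 < θ) : Orthonormal ℂ (basisVec θ hθ) := by
  rw [orthonormal_iff_ite]
  intro m n
  rw [basisVec, basisVec, inner_smul_left, inner_smul_right, inner_toLp_basisFun]
  by_cases h : m = n
  · rw [if_pos h, if_pos h, Complex.conj_ofReal]
    have := Real.mul_self_sqrt (show 0 ≤ 2 * Real.pi * θ by positivity)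
    have h0 : Real.sqrt (2 * Real.pi * θ) ≠ 0 := by positivity
    norm_cast
    field_simp
    linarith
  · rw [if_neg h, if_neg h]; simp

/-! ### Left Moyal multiplication as a bounded operator on `L²` -/

section LeftMul

variable {θ : ℝ} {a B : 𝓢(Plane, ℂ)}

/-- The phase is unimodular, so the twisted convolution obeys the same Young bound as an ordinary
one. -/
lemma eLpNorm_leftMul_le (hB : ∀ z, ∫ y, a y * phase θ y z = B z) {b : Plane → ℂ}
    (hb : Measurable b) :
    eLpNorm (leftMul θ a b) 2 volume ≤
      (∫⁻ z, ‖((((Real.pi * θ) ^ 2)⁻¹ : ℝ) : ℂ) * B z‖ₑ) * eLpNorm b 2 volume := by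
  have hm := B.continuous.measurable
  refine eLpNorm_le_of_le_conv (by fun_prop) (by fun_prop) fun x => ?_
  rw [leftMul_eq_twistedConv hB, ← integral_const_mul]
  refine (enorm_integral_le_lintegral_enorm _).trans_eq (lintegral_congr fun z => ?_)
  have : ‖phase θ (-x) z‖ₑ = 1 := by rw [← ofReal_norm, norm_phase]; simp
  rw [enorm_mul, enorm_mul, enorm_mul, enorm_mul, this, mul_one, mul_assoc]

lemma differentiable_leftMul (hθ : 0 < θ) (hB : ∀ z, ∫ y, a y * phase θ y z = B z)
    {b : Plane → ℂ} (hb : MemLp b 2 volume) : Differentiable ℝ (leftMul θ a b) := by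
  rw [funext (leftMul_eq_kernel hB b)]
  exact fun x => (hasFDerivAt_integral_kernel θ hθ B hb x).differentiableAt.const_mul _

lemma memLp_leftMul (hθ : 0 < θ) (hB : ∀ z, ∫ y, a y * phase θ y z = B z) {b : Plane → ℂ}
    (hbm : Measurable b) (hb : MemLp b 2 volume) : MemLp (leftMul θ a b) 2 volume := by
  refine ⟨(differentiable_leftMul hθ hB hb).continuous.aestronglyMeasurable,
    (eLpNorm_leftMul_le hB hbm).trans_lt (ENNReal.mul_lt_top ?_ hb.2)⟩
  exact (B.integrable.const_mul _).2

lemma leftMul_add (hθ : 0 < θ) (hB : ∀ z, ∫ y, a y * phase θ y z = B z) {b b' : Plane → ℂ}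
    (hb : MemLp b 2 volume) (hb' : MemLp b' 2 volume) (x : Plane) :
    leftMul θ a (fun w => b w + b' w) x = leftMul θ a b x + leftMul θ a b' x := by
  simp only [leftMul_eq_kernel hB, mul_add (B _ * phase _ _ _)]
  rw [integral_add (integrable_kernel_mul θ hθ B hb x) (integrable_kernel_mul θ hθ B hb' x),
    mul_add]

lemma leftMul_const_mul (c : ℂ) (b : Plane → ℂ) (x : Plane) :
    leftMul θ a (fun w => c * b w) x = c * leftMul θ a b x := by
  unfold leftMul
  simp only [mul_left_comm _ c]
  rw [integral_const_mul]
  ring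

/-- Lets left multiplication descend from functions to classes in `L²`. -/
lemma leftMul_congr {b b' : Plane → ℂ} (h : b =ᵐ[volume] b') : leftMul θ a b = leftMul θ a b' := by
  ext x
  unfold leftMul
  congr 1
  refine integral_congr_ae ?_
  filter_upwards [(measurePreserving_add_left volume x).quasiMeasurePreserving.ae_eq_comp h]
    with z hz
  rw [show b (x + z) = b' (x + z) from hz]

/-- Left Moyal multiplication with a Schwartz function, as a bounded operator on `L²`. -/
noncomputable def leftMulCLM (hθ : 0 < θ) (hB : ∀ z, ∫ y, a y * phase θ y z = B z) :
    Lp ℂ 2 (volume : Measure Plane) →L[ℂ] Lp ℂ 2 (volume : Measure Plane) :=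
  LinearMap.mkContinuous
    { toFun := fun ψ => (memLp_leftMul hθ hB (Lp.stronglyMeasurable ψ).measurable
        (Lp.memLp ψ)).toLp _
      map_add' := fun ψ φ => by
        rw [← MemLp.toLp_add]
        congr 1
        rw [leftMul_congr (Lp.coeFn_add ψ φ)]
        ext x
        exact leftMul_add hθ hB (Lp.memLp ψ) (Lp.memLp φ) x
      map_smul' := fun c ψ => by
        rw [RingHom.id_apply, ← MemLp.toLp_const_smul]
        congr 1
        rw [leftMul_congr (Lp.coeFn_smul c ψ)]
        ext x
        exact leftMul_const_mul c ψ x }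
    (∫⁻ z, ‖((((Real.pi * θ) ^ 2)⁻¹ : ℝ) : ℂ) * B z‖ₑ).toReal
    (fun ψ => by
      change ‖(memLp_leftMul hθ hB (Lp.stronglyMeasurable ψ).measurable (Lp.memLp ψ)).toLp _‖ ≤ _
      rw [Lp.norm_toLp, Lp.norm_def, ← ENNReal.toReal_mul]
      refine ENNReal.toReal_mono (ENNReal.mul_ne_top ?_ (Lp.eLpNorm_ne_top ψ))
        (eLpNorm_leftMul_le hB (Lp.stronglyMeasurable ψ).measurable)
      exact (B.integrable.const_mul _).2.ne)

lemma coeFn_leftMulCLM (hθ : 0 < θ) (hB : ∀ z, ∫ y, a y * phase θ y z = B z)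
    (ψ : Lp ℂ 2 (volume : Measure Plane)) : leftMulCLM hθ hB ψ =ᵐ[volume] leftMul θ a ψ :=
  (memLp_leftMul hθ hB (Lp.stronglyMeasurable ψ).measurable (Lp.memLp ψ)).coeFn_toLp

lemma vectorState_eq_inner (hθ : 0 < θ) (hB : ∀ z, ∫ y, a y * phase θ y z = B z)
    (ψ : Lp ℂ 2 (volume : Measure Plane)) :
    vectorState θ ψ a = inner ℂ ψ (leftMulCLM hθ hB ψ) := by
  rw [vectorState, L2.inner_def]
  refine integral_congr_ae ?_
  filter_upwards [coeFn_leftMulCLM hθ hB ψ] with x hx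
  rw [hx]
  simp [rep, PiLp.inner_apply, Fin.sum_univ_two]

/-! ### The commutator with the Dirac operator -/

lemma differentiableAt_spinor {F : Plane → Spinor} {x : Plane}
    (h : ∀ i, DifferentiableAt ℝ (fun x => F x i) x) : DifferentiableAt ℝ F x :=
  (PiLp.continuousLinearEquiv 2 ℝ fun _ : Fin 2 => ℂ).symm.differentiableAt.comp x
    (differentiableAt_pi.2 h)

lemma fderiv_spinor_apply {F : Plane → Spinor} {x : Plane} (h : DifferentiableAt ℝ F x)
    (v : Plane) (i : Fin 2) : fderiv ℝ F x v i = fderiv ℝ (fun x => F x i) x v := by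
  have := ((EuclideanSpace.proj (𝕜 := ℂ) i : Spinor →L[ℂ] ℂ).restrictScalars ℝ).hasFDerivAt.comp x
    h.hasFDerivAt
  have h2 : HasFDerivAt (fun x => F x i) _ x := this
  rw [h2.fderiv]
  rfl

lemma dirac_apply_zero {F : Plane → Spinor} {x : Plane} (h : DifferentiableAt ℝ F x) :
    dirac F x 0 = -Complex.I * fderiv ℝ (fun x => F x 1) x (e 0) +
      fderiv ℝ (fun x => F x 1) x (e 1) := by
  rw [← fderiv_spinor_apply h, ← fderiv_spinor_apply h]
  simp [dirac, sigma, Fin.sum_univ_two]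
  linear_combination (-(fderiv ℝ F x (e 1) 1)) * Complex.I_mul_I

lemma dirac_apply_one {F : Plane → Spinor} {x : Plane} (h : DifferentiableAt ℝ F x) :
    dirac F x 1 = -Complex.I * fderiv ℝ (fun x => F x 0) x (e 0) +
      -1 * fderiv ℝ (fun x => F x 0) x (e 1) := by
  rw [← fderiv_spinor_apply h, ← fderiv_spinor_apply h]
  simp [dirac, sigma, Fin.sum_univ_two]
  linear_combination (fderiv ℝ F x (e 1) 0) * Complex.I_mul_I

lemma enorm_spinor_le (v : Spinor) : ‖v‖ₑ ≤ ‖v 0‖ₑ + ‖v 1‖ₑ := by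
  have h : ‖v‖ ≤ ‖v 0‖ + ‖v 1‖ := by
    rw [EuclideanSpace.norm_eq, Fin.sum_univ_two]
    refine Real.sqrt_le_iff.2 ⟨by positivity, ?_⟩
    nlinarith [norm_nonneg (v 0), norm_nonneg (v 1)]
  rw [← ofReal_norm, ← ofReal_norm, ← ofReal_norm, ← ENNReal.ofReal_add (by simp) (by simp)]
  exact ENNReal.ofReal_le_ofReal h

lemma memLp_spinor_apply {F : Plane → Spinor} (h : MemLp F 2 volume) (i : Fin 2) :
    MemLp (fun x => F x i) 2 volume :=
  h.of_le ((EuclideanSpace.proj (𝕜 := ℂ) i).continuous.comp_aestronglyMeasurable h.1)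
    (Filter.Eventually.of_forall fun _ => PiLp.norm_apply_le _ i)

lemma InDomD.memLp {Ψ : Plane → Spinor} (h : InDomD Ψ) : MemLp Ψ 2 volume :=
  (memLp_congr_norm h.1.continuous.aestronglyMeasurable (h.2 0).1
    (by simp)).2 (h.2 0)

lemma InDomD.memLp_fderiv {Ψ : Plane → Spinor} (h : InDomD Ψ) (v : Plane) (i : Fin 2) :
    MemLp (fun x => fderiv ℝ (fun x => Ψ x i) x v) 2 volume := by
  have hd : Differentiable ℝ Ψ := h.1.differentiable (by simp)
  have hc : Continuous (fderiv ℝ Ψ) := h.1.continuous_fderiv (by simp)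
  simp_rw [← fun x => fderiv_spinor_apply (hd x) v i]
  refine memLp_spinor_apply ?_ i
  refine (h.2 1).of_le_mul (c := ‖v‖) (by fun_prop) (Filter.Eventually.of_forall fun x => ?_)
  rw [norm_iteratedFDeriv_one, mul_comm]
  exact (fderiv ℝ Ψ x).le_opNorm v

lemma enorm_fderiv_leftMul_sub_le (hθ : 0 < θ) (hB : ∀ z, ∫ y, a y * phase θ y z = B z)
    {Ψ : Plane → Spinor} (h : InDomD Ψ) (μ i : Fin 2) (x : Plane) :
    ‖fderiv ℝ (leftMul θ a fun w => Ψ w i) x (e μ) -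
        leftMul θ a (fun w => fderiv ℝ (fun w => Ψ w i) w (e μ)) x‖ₑ ≤
      ∫⁻ z, ENNReal.ofReal (((Real.pi * θ) ^ 2)⁻¹ * (4 / θ) * (‖z‖ * ‖B z‖)) * ‖Ψ (x + z)‖ₑ := by
  have hd : Differentiable ℝ Ψ := h.1.differentiable (by simp)
  have hdi : Differentiable ℝ fun w => Ψ w i :=
    fun w => (((EuclideanSpace.proj (𝕜 := ℂ) i : Spinor →L[ℂ] ℂ).restrictScalars
      ℝ).differentiableAt).comp w (hd w)
  rw [fderiv_leftMul_sub hθ hB hdi (memLp_spinor_apply h.memLp i) (e μ)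
    (h.memLp_fderiv (e μ) i), ← integral_const_mul]
  refine (enorm_integral_le_lintegral_enorm _).trans (lintegral_mono fun z => ?_)
  rw [← ofReal_norm, ← ofReal_norm (Ψ (x + z)), ← ENNReal.ofReal_mul (by positivity)]
  refine ENNReal.ofReal_le_ofReal ?_
  have h1 := abs_twist_le θ hθ (e μ) z
  have h2 : ‖e μ‖ = 1 := by simp [e]
  rw [h2, one_mul] at h1
  have h3 := PiLp.norm_apply_le (Ψ (x + z)) i
  have h4 : ‖((((Real.pi * θ) ^ 2)⁻¹ : ℝ) : ℂ)‖ = ((Real.pi * θ) ^ 2)⁻¹ := by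
    rw [Complex.norm_real, Real.norm_of_nonneg (by positivity)]
  rw [norm_mul, h4, norm_mul, norm_mul, norm_mul, norm_mul, norm_mul, norm_phase, Complex.norm_I,
    Complex.norm_real, Complex.norm_two, Real.norm_eq_abs]
  calc ((Real.pi * θ) ^ 2)⁻¹ * (2 * 1 * |twist θ (e μ) z| * (‖B z‖ * 1 * ‖Ψ (x + z) i‖))
      ≤ ((Real.pi * θ) ^ 2)⁻¹ * (2 * 1 * (2 / θ * ‖z‖) * (‖B z‖ * 1 * ‖Ψ (x + z)‖)) := by gcongr
    _ = _ := by ring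

/-- The commutator `[D, π(a)]` is dominated by a convolution. -/
lemma commutatorNorm_le (hθ : 0 < θ) (hB : ∀ z, ∫ y, a y * phase θ y z = B z) :
    commutatorNorm θ a ≤
      4 * ∫⁻ z, ENNReal.ofReal (((Real.pi * θ) ^ 2)⁻¹ * (4 / θ) * (‖z‖ * ‖B z‖)) := by
  have hm := B.continuous.measurable
  set k : Plane → ℝ≥0∞ :=
    fun z => ENNReal.ofReal (((Real.pi * θ) ^ 2)⁻¹ * (4 / θ) * (‖z‖ * ‖B z‖)) with hk
  have hkm : Measurable k := by fun_prop
  refine iSup_le fun Ψ => iSup_le fun h => iSup_le fun hn => ?_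
  have hd : Differentiable ℝ Ψ := h.1.differentiable (by simp)
  have hrd : Differentiable ℝ (rep θ a Ψ) := fun x => differentiableAt_spinor fun i =>
    differentiable_leftMul hθ hB (memLp_spinor_apply h.memLp i) x
  have hmem := fun μ i => h.memLp_fderiv (e μ) i
  rw [← lintegral_const_mul _ hkm]
  refine (eLpNorm_le_of_le_conv (G := Ψ) (hkm.const_mul 4)
    h.1.continuous.enorm.measurable fun x => ?_).trans (mul_le_of_le_one_right zero_le hn)
  set S : ℝ≥0∞ := ∫⁻ z, k z * ‖Ψ (x + z)‖ₑ with hS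
  set D : Fin 2 → Fin 2 → ℂ := fun μ i => fderiv ℝ (leftMul θ a fun w => Ψ w i) x (e μ) -
    leftMul θ a (fun w => fderiv ℝ (fun w => Ψ w i) w (e μ)) x with hD
  have hDS : ∀ μ i, ‖D μ i‖ₑ ≤ S := fun μ i => enorm_fderiv_leftMul_sub_le hθ hB h μ i x
  have hadd : ∀ (c c' : ℂ) (i : Fin 2), leftMul θ a (fun w =>
      c * fderiv ℝ (fun x => Ψ x i) w (e 0) + c' * fderiv ℝ (fun x => Ψ x i) w (e 1)) x =
      c * leftMul θ a (fun w => fderiv ℝ (fun x => Ψ x i) w (e 0)) x +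
        c' * leftMul θ a (fun w => fderiv ℝ (fun x => Ψ x i) w (e 1)) x := by
    intro c c' i
    rw [leftMul_add hθ hB ((hmem 0 i).const_mul c) ((hmem 1 i).const_mul c'), leftMul_const_mul,
      leftMul_const_mul]
  -- The constant matrices `σ^μ` are off-diagonal with unimodular entries and commute with the
  -- componentwise action of `a`. Each component of the commutator thus combines two of the `D μ i`;
  -- the four terms together account for the constant 4.
  have h0 : (dirac (rep θ a Ψ) x - rep θ a (dirac Ψ) x) 0 = -Complex.I * D 0 1 + D 1 1 := by
    have e1 : rep θ a (dirac Ψ) x 0 = leftMul θ a (fun w => dirac Ψ w 0) x := rfl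
    have e2 := hadd (-Complex.I) 1 1
    simp only [one_mul] at e2
    rw [PiLp.sub_apply, e1, dirac_apply_zero (hrd x)]
    simp only [fun w => dirac_apply_zero (hd w), e2, hD]
    change _ * fderiv ℝ (leftMul θ a fun w => Ψ w 1) x _ +
      fderiv ℝ (leftMul θ a fun w => Ψ w 1) x _ - _ = _
    ring
  have h1 : (dirac (rep θ a Ψ) x - rep θ a (dirac Ψ) x) 1 = -Complex.I * D 0 0 - D 1 0 := by
    have e1 : rep θ a (dirac Ψ) x 1 = leftMul θ a (fun w => dirac Ψ w 1) x := rfl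
    rw [PiLp.sub_apply, e1, dirac_apply_one (hrd x)]
    simp only [fun w => dirac_apply_one (hd w), hadd, hD]
    change _ * fderiv ℝ (leftMul θ a fun w => Ψ w 0) x _ +
      _ * fderiv ℝ (leftMul θ a fun w => Ψ w 0) x _ - _ = _
    ring
  have hI : ∀ c : ℂ, ‖-Complex.I * c‖ₑ = ‖c‖ₑ := fun c => by
    rw [enorm_mul, enorm_neg, ← ofReal_norm Complex.I]; simp
  calc ‖dirac (rep θ a Ψ) x - rep θ a (dirac Ψ) x‖ₑ
      ≤ (‖D 0 1‖ₑ + ‖D 1 1‖ₑ) + (‖D 0 0‖ₑ + ‖D 1 0‖ₑ) := by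
        refine (enorm_spinor_le _).trans (add_le_add ?_ ?_)
        · rw [h0, ← hI (D 0 1)]; exact enorm_add_le _ _
        · rw [h1, ← hI (D 0 0)]; exact enorm_sub_le
    _ ≤ (S + S) + (S + S) := by gcongr <;> exact hDS _ _
    _ = 4 * S := by ring
    _ = ∫⁻ z, 4 * k z * ‖Ψ (x + z)‖ₑ := by
        have hc := h.1.continuous.enorm.measurable
        rw [hS, ← lintegral_const_mul _ (show Measurable fun z => k z * ‖Ψ (x + z)‖ₑ from
          hkm.mul (hc.comp (measurable_const_add x)))]
        simp only [mul_assoc]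

end LeftMul

/-! ### Scaling of the commutator bound for Gaussians -/

/-- Substituting `√τ z`: the planar Jacobian gives `τ⁻¹` and the weight `‖z‖` gives `τ^{-1/2}`. -/
lemma integral_norm_mul_gaussian_scale (θ τ : ℝ) (hτ : 0 < τ) :
    ∫ z : Plane, ‖z‖ * Real.exp (-(τ / θ ^ 2 * ‖z‖ ^ 2)) =
      (τ * Real.sqrt τ)⁻¹ * ∫ z : Plane, ‖z‖ * Real.exp (-(1 / θ ^ 2 * ‖z‖ ^ 2)) := by
  have h := Measure.integral_comp_smul (volume : Measure Plane)
    (fun z => ‖z‖ * Real.exp (-(1 / θ ^ 2 * ‖z‖ ^ 2))) (Real.sqrt τ)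
  have hs : 0 < Real.sqrt τ := Real.sqrt_pos.2 hτ
  have hsq := Real.sq_sqrt hτ.le
  rw [finrank_euclideanSpace_fin, hsq, abs_of_pos (by positivity), smul_eq_mul] at h
  have h2 : ∀ z : Plane, ‖Real.sqrt τ • z‖ * Real.exp (-(1 / θ ^ 2 * ‖Real.sqrt τ • z‖ ^ 2)) =
      Real.sqrt τ * (‖z‖ * Real.exp (-(τ / θ ^ 2 * ‖z‖ ^ 2))) := by
    intro z
    rw [norm_smul, Real.norm_of_nonneg hs.le, mul_pow, hsq]
    ring_nf
  simp_rw [h2] at h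
  rw [integral_const_mul] at h
  rw [mul_inv, mul_right_comm, ← h, mul_comm, ← mul_assoc, inv_mul_cancel₀ hs.ne', one_mul]

lemma integrable_norm_mul_gaussian {l : ℝ} (hl : 0 < l) :
    Integrable fun z : Plane => ‖z‖ * Real.exp (-(l * ‖z‖ ^ 2)) := by
  have hg : ExpGrowth fun z => ((‖z‖ : ℝ) : ℂ) := by
    refine ⟨by fun_prop, 1, 1, zero_le_one, fun x => ?_⟩
    rw [Complex.norm_real, norm_norm]
    linarith [Real.add_one_le_exp (1 * ‖x‖)]
  refine (hg.integrable hl).norm.congr (Filter.Eventually.of_forall fun z => ?_)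
  simp only [gaussian, norm_mul, Complex.norm_real, norm_norm, Real.norm_of_nonneg
    (Real.exp_pos _).le]
  ring

/-- The commutator norm of a Gaussian of width `τ` is at most of order `τ^(-1/2)`. -/
lemma exists_commutatorNorm_gaussian_le (θ : ℝ) (hθ : 0 < θ) :
    ∃ C : ℝ, 0 < C ∧ ∀ (τ : ℝ) (hτ : 0 < τ) (r : ℝ), 0 ≤ r →
      commutatorNorm θ ((r : ℂ) • f00 τ hτ) ≤ ENNReal.ofReal (C * r / Real.sqrt τ) := by
  set J : ℝ := ∫ z : Plane, ‖z‖ * Real.exp (-(1 / θ ^ 2 * ‖z‖ ^ 2)) with hJ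
  have hJ0 : 0 ≤ J := integral_nonneg fun z => by positivity
  set C₀ : ℝ := 4 * (((Real.pi * θ) ^ 2)⁻¹ * (4 / θ) * (2 * Real.pi)) with hC₀
  have hC₀' : 0 < C₀ := by positivity
  -- `J + 1` instead of `J` makes positivity of the constant immediate.
  refine ⟨C₀ * (J + 1), by positivity, fun τ hτ r hr => ?_⟩
  refine (commutatorNorm_le hθ (integral_smul_f00_mul_phase θ τ hθ hτ r)).trans ?_
  have h1 : ∀ z : Plane, ((Real.pi * θ) ^ 2)⁻¹ * (4 / θ) * (‖z‖ * ‖gaussHat θ τ hθ hτ r z‖) =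
      (((Real.pi * θ) ^ 2)⁻¹ * (4 / θ) * (2 * r * (Real.pi * τ))) *
        (‖z‖ * Real.exp (-(τ / θ ^ 2 * ‖z‖ ^ 2))) := by
    intro z
    rw [gaussHat_apply, gaussian, norm_mul, Complex.norm_real, Complex.norm_real,
      Real.norm_of_nonneg (by positivity), Real.norm_of_nonneg (Real.exp_pos _).le]
    ring
  simp_rw [h1]
  rw [← ofReal_integral_eq_lintegral_ofReal
    ((integrable_norm_mul_gaussian (by positivity)).const_mul _)
    (Filter.Eventually.of_forall fun z => by positivity), integral_const_mul,
    integral_norm_mul_gaussian_scale θ τ hτ, ← hJ,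
    show (4 : ℝ≥0∞) = ENNReal.ofReal 4 by simp, ← ENNReal.ofReal_mul (by norm_num)]
  refine ENNReal.ofReal_le_ofReal ?_
  have hs : 0 < Real.sqrt τ := Real.sqrt_pos.2 hτ
  -- The amplitude `τ` of the transform against `τ^{-3/2}` from scaling leaves `τ^{-1/2}`.
  calc 4 * (((Real.pi * θ) ^ 2)⁻¹ * (4 / θ) * (2 * r * (Real.pi * τ)) *
          ((τ * Real.sqrt τ)⁻¹ * J)) = C₀ * J * r / Real.sqrt τ := by
        rw [hC₀]; field_simp
    _ ≤ _ := by gcongr; linarith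

/-! ### The weights of the vectors `ψ(s)` -/

/-- The weights `1 / (ζ(s) (m+1)^s)` of the zeta distribution. -/
noncomputable def zetaWeight (s : ℝ) (m : ℕ) : ℝ :=
  1 / ((riemannZeta (s : ℂ)).re * ((m : ℝ) + 1) ^ s)

lemma summable_add_one_rpow {s : ℝ} (hs : 1 < s) :
    Summable fun m : ℕ => 1 / ((m : ℝ) + 1) ^ s := by
  have := (summable_nat_add_iff 1).2 (Real.summable_one_div_nat_rpow.2 hs)
  simpa using this

lemma riemannZeta_re_eq_tsum {s : ℝ} (hs : 1 < s) :
    (riemannZeta (s : ℂ)).re = ∑' m : ℕ, 1 / ((m : ℝ) + 1) ^ s := by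
  rw [zeta_eq_tsum_one_div_nat_add_one_cpow (by simpa using hs)]
  have : ∀ m : ℕ, 1 / ((m : ℂ) + 1) ^ (s : ℂ) = ((1 / ((m : ℝ) + 1) ^ s : ℝ) : ℂ) := by
    intro m
    rw [Complex.ofReal_div, Complex.ofReal_cpow (by positivity)]
    push_cast
    rfl
  simp_rw [this]
  rw [← Complex.ofReal_tsum, Complex.ofReal_re]

lemma riemannZeta_re_pos {s : ℝ} (hs : 1 < s) : 0 < (riemannZeta (s : ℂ)).re := by
  rw [riemannZeta_re_eq_tsum hs]
  exact (summable_add_one_rpow hs).tsum_pos (fun m => by positivity) 0 (by simp)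

lemma zetaWeight_pos {s : ℝ} (hs : 1 < s) (m : ℕ) : 0 < zetaWeight s m := by
  have := riemannZeta_re_pos hs
  unfold zetaWeight; positivity

lemma hasSum_zetaWeight {s : ℝ} (hs : 1 < s) : HasSum (zetaWeight s) 1 := by
  have h := (summable_add_one_rpow hs).hasSum.mul_left (riemannZeta (s : ℂ)).re⁻¹
  rw [← riemannZeta_re_eq_tsum hs, inv_mul_cancel₀ (riemannZeta_re_pos hs).ne'] at h
  have he : zetaWeight s =
      fun m : ℕ => (riemannZeta (s : ℂ)).re⁻¹ * (1 / ((m : ℝ) + 1) ^ s) := by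
    ext m
    rw [zetaWeight, one_div, one_div, mul_inv]
  rwa [he]

/-- The generating functions of two zeta distributions differ near `1` by more than any multiple
of `√(1 - q)`. -/
lemma exists_lt_abs_tsum_zetaWeight_sub {s t : ℝ} (hs : 1 < s) (hst : s < t) (ht : t ≤ 3 / 2)
    (M : ℝ) : ∃ n : ℕ, 1 ≤ n ∧ M * Real.sqrt (1 / n) ≤
      |∑' m, zetaWeight s m * (1 - 1 / n : ℝ) ^ m - ∑' m, zetaWeight t m * (1 - 1 / n : ℝ) ^ m| := by
  have ht1 : 1 < t := hs.trans hst
  have hps := zetaWeight_pos hs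
  have hpt := zetaWeight_pos ht1
  -- far out, the first weights dominate the second ones
  obtain ⟨K, hK⟩ : ∃ K : ℕ, ∀ m ≥ K, 2 * zetaWeight t m ≤ zetaWeight s m := by
    have h := ((tendsto_rpow_atTop (sub_pos.2 hst)).comp
      (tendsto_natCast_atTop_atTop (R := ℝ))).eventually_ge_atTop
        (2 * (riemannZeta (s : ℂ)).re / (riemannZeta (t : ℂ)).re)
    obtain ⟨K, hK⟩ := Filter.eventually_atTop.1 h
    refine ⟨K, fun m hm => ?_⟩
    have h1 := hK (m + 1) (by omega)
    have hzs := riemannZeta_re_pos hs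
    have hzt := riemannZeta_re_pos ht1
    have hm1 : (0 : ℝ) < (m : ℝ) + 1 := by positivity
    have hpow := Real.rpow_pos_of_pos hm1 s
    have hpow' := Real.rpow_pos_of_pos hm1 t
    simp only [Function.comp_apply, Nat.cast_add, Nat.cast_one] at h1
    rw [Real.rpow_sub hm1, div_le_div_iff₀ hzt hpow] at h1
    rw [zetaWeight, zetaWeight, mul_one_div, div_le_div_iff₀ (by positivity) (by positivity)]
    linarith
  set d : ℕ → ℝ := fun m => zetaWeight s m - zetaWeight t m with hd
  have hd0 : HasSum d 0 := by simpa using (hasSum_zetaWeight hs).sub (hasSum_zetaWeight ht1)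
  set A : ℝ := ∑ m ∈ Finset.range K, |d m| * m with hA
  -- a lower bound for the difference of the generating functions
  have main : ∀ n : ℕ, K ≤ n → 1 ≤ n → n / 4 * zetaWeight s (2 * n) - A * (1 / n) ≤
      |∑' m, zetaWeight s m * (1 - 1 / n : ℝ) ^ m -
        ∑' m, zetaWeight t m * (1 - 1 / n : ℝ) ^ m| := by
    intro n hKn hn
    have hn' : (1 : ℝ) ≤ n := by exact_mod_cast hn
    set q : ℝ := 1 - 1 / n with hq
    have hq0 : 0 ≤ q := by rw [hq, sub_nonneg, div_le_one (by positivity)]; exact hn'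
    have hq1 : q ≤ 1 := by rw [hq]; linarith [show (0 : ℝ) ≤ 1 / n by positivity]
    have hsum : ∀ {u : ℝ}, 1 < u → Summable fun m => zetaWeight u m * q ^ m := fun {u} hu =>
      (hasSum_zetaWeight hu).summable.of_nonneg_of_le
        (fun m => mul_nonneg (zetaWeight_pos hu m).le (pow_nonneg hq0 m))
        (fun m => mul_le_of_le_one_right (zetaWeight_pos hu m).le (pow_le_one₀ hq0 hq1))
    -- Because `∑ d m = 0`, one may insert `1 - q^m`, which is at most `m/n` for small `m` and at
    -- least `1/2` for `m ≥ n`.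
    have hS : HasSum (fun m => d m * (1 - q ^ m))
        (-(∑' m, zetaWeight s m * q ^ m - ∑' m, zetaWeight t m * q ^ m)) := by
      have := hd0.sub ((hsum hs).hasSum.sub (hsum ht1).hasSum)
      rw [zero_sub] at this
      have he : (fun m => d m * (1 - q ^ m)) =
          fun m => d m - (zetaWeight s m * q ^ m - zetaWeight t m * q ^ m) := by
        ext m
        simp only [hd]
        ring
      rwa [he]
    have hqn : q ^ n ≤ 1 / 2 :=
      (Real.one_sub_div_pow_le_exp_neg hn').trans (by linarith [Real.exp_neg_one_lt_d9])
    have hlow : ∀ m, K ≤ m → 0 ≤ d m * (1 - q ^ m) := fun m hm =>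
      mul_nonneg (by have := hK m hm; have := hpt m; simp only [hd]; linarith)
        (sub_nonneg.2 (pow_le_one₀ hq0 hq1))
    have hfin : ∑ m ∈ Finset.range (2 * n), d m * (1 - q ^ m) ≤
        -(∑' m, zetaWeight s m * q ^ m - ∑' m, zetaWeight t m * q ^ m) := by
      refine sum_le_hasSum _ (fun m hm => hlow m ?_) hS
      simp only [Finset.mem_range, not_lt] at hm
      omega
    -- One factor `1/2` comes from `d m ≥ p_s(m)/2`, the other from `1 - q^m ≥ 1/2`.
    have hanti : ∀ m ∈ Finset.Ico n (2 * n), 1 / 4 * zetaWeight s (2 * n) ≤ d m * (1 - q ^ m) := by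
      intro m hm
      rw [Finset.mem_Ico] at hm
      have h1 : zetaWeight s (2 * n) ≤ zetaWeight s m := by
        have := riemannZeta_re_pos hs
        unfold zetaWeight
        gcongr
        exact_mod_cast hm.2.le
      have h2 : 1 / 2 * zetaWeight s m ≤ d m := by
        have := hK m (hKn.trans hm.1)
        simp only [hd]; linarith
      have h3 : q ^ m ≤ 1 / 2 := (pow_le_pow_of_le_one hq0 hq1 hm.1).trans hqn
      have := hps (2 * n)
      nlinarith
    have hsplit : n / 4 * zetaWeight s (2 * n) - A * (1 / n) ≤
        ∑ m ∈ Finset.range (2 * n), d m * (1 - q ^ m) := by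
      have h1 : ∑ m ∈ Finset.Ico n (2 * n), d m * (1 - q ^ m) ≥ n / 4 * zetaWeight s (2 * n) := by
        refine le_trans (le_of_eq ?_) (Finset.card_nsmul_le_sum _ _ _ hanti)
        rw [Nat.card_Ico, nsmul_eq_mul, show 2 * n - n = n by omega]
        ring
      have h2 : 0 ≤ ∑ m ∈ Finset.Ico K n, d m * (1 - q ^ m) :=
        Finset.sum_nonneg fun m hm => hlow m (Finset.mem_Ico.1 hm).1
      have h3 : -(A * (1 / n)) ≤ ∑ m ∈ Finset.range K, d m * (1 - q ^ m) := by
        rw [hA, Finset.sum_mul, ← Finset.sum_neg_distrib]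
        refine Finset.sum_le_sum fun m _ => ?_
        -- Bernoulli's inequality; it makes the head of the sum `O(1/n)`.
        have hb : 1 - q ^ m ≤ m * (1 / n) := by
          have := one_add_mul_le_pow (a := -(1 / n : ℝ)) (by
            have : (1 : ℝ) / n ≤ 1 := by rw [div_le_one (by positivity)]; exact hn'
            linarith) m
          rw [hq]
          rw [← sub_eq_add_neg] at this
          linarith
        have hb0 : 0 ≤ 1 - q ^ m := sub_nonneg.2 (pow_le_one₀ hq0 hq1)
        calc -(|d m| * m * (1 / n)) = -(|d m| * (m * (1 / n))) := by ring
          _ ≤ -(|d m| * (1 - q ^ m)) := by gcongr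
          _ ≤ _ := by nlinarith [neg_abs_le (d m)]
      rw [Finset.range_eq_Ico, ← Finset.sum_Ico_consecutive _ (Nat.zero_le n) (by omega),
        ← Finset.sum_Ico_consecutive _ (Nat.zero_le K) hKn, ← Finset.range_eq_Ico]
      linarith
    exact (hsplit.trans hfin).trans (neg_le_abs _)
  -- the lower bound dominates `n ^ (-1/2)`
  have hzs := riemannZeta_re_pos hs
  -- The `4` is that of `n / 4` in `main`; `3 ^ s` comes from `2n + 1 ≤ 3n`.
  set c : ℝ := 1 / (4 * ((riemannZeta (s : ℂ)).re * 3 ^ s)) with hc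
  have hc0 : 0 < c := by positivity
  -- The exponent is positive since `s < t ≤ 3/2`, even when `t = 3/2`. The error `A/n` is absorbed
  -- into `M + A` through `1/n ≤ √(1/n)`.
  have h := ((tendsto_rpow_atTop (show 0 < 3 / 2 - s by linarith)).comp
      (tendsto_natCast_atTop_atTop (R := ℝ))).eventually_ge_atTop ((M + A) / c)
  obtain ⟨n, hn1, hn2⟩ := (h.and (Filter.eventually_ge_atTop (max K 1))).exists
  have hnK : K ≤ n := (le_max_left _ _).trans hn2
  have hn : 1 ≤ n := (le_max_right _ _).trans hn2
  refine ⟨n, hn, le_trans ?_ (main n hnK hn)⟩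
  have hn' : (1 : ℝ) ≤ n := by exact_mod_cast hn
  have hn0 : (0 : ℝ) < n := by linarith
  have hA0 : 0 ≤ A := Finset.sum_nonneg fun m _ => by positivity
  rw [Function.comp_apply, div_le_iff₀ hc0] at hn1
  have hr : (n : ℝ) ^ (3 / 2 - s) * Real.sqrt (1 / n) = n / (n : ℝ) ^ s := by
    rw [Real.sqrt_eq_rpow, one_div, Real.inv_rpow hn0.le, ← Real.rpow_neg hn0.le,
      ← Real.rpow_add hn0]
    rw [show (n : ℝ) / (n : ℝ) ^ s = (n : ℝ) ^ (1 - s) by rw [Real.rpow_sub hn0, Real.rpow_one]]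
    congr 1
    ring
  have hw : c * (n / (n : ℝ) ^ s) ≤ n / 4 * zetaWeight s (2 * n) := by
    have h3 : ((2 * n : ℕ) + 1 : ℝ) ^ s ≤ 3 ^ s * (n : ℝ) ^ s := by
      rw [← Real.mul_rpow (by norm_num) hn0.le]
      refine Real.rpow_le_rpow (by positivity) ?_ (by linarith)
      push_cast
      linarith
    calc c * (n / (n : ℝ) ^ s)
        = n / 4 * (1 / ((riemannZeta (s : ℂ)).re * (3 ^ s * (n : ℝ) ^ s))) := by
          rw [hc]; field_simp
      _ ≤ _ := by unfold zetaWeight; gcongr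
  have hsq : (1 : ℝ) / n ≤ Real.sqrt (1 / n) := by
    refine Real.le_sqrt_of_sq_le ?_
    have : (1 : ℝ) / n ≤ 1 := by rw [div_le_one hn0]; exact hn'
    have h0 : (0 : ℝ) ≤ 1 / n := by positivity
    nlinarith
  have h5 : (M + A) * Real.sqrt (1 / n) ≤ (n : ℝ) ^ (3 / 2 - s) * c * Real.sqrt (1 / n) := by
    gcongr
  have h6 : (n : ℝ) ^ (3 / 2 - s) * c * Real.sqrt (1 / n) = c * (n / (n : ℝ) ^ s) := by
    rw [← hr]; ring
  have h7 : A * (1 / n) ≤ A * Real.sqrt (1 / n) := by gcongr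
  linarith

/-! ### The vectors `ψ(s)` and their states -/

/-- An infinite sum defaults to `0` when it diverges, so convergence must be proved: the family is
orthonormal and the squared coefficients `zetaWeight s m` are summable. -/
lemma hasSum_psi (θ : ℝ) (hθ : 0 < θ) {s : ℝ} (hs : 1 < s) :
    HasSum (fun m => ((Real.sqrt (zetaWeight s m) : ℝ) : ℂ) • basisVec θ hθ m) (psi θ hθ s) := by
  have hsum : Summable fun m => ((Real.sqrt (zetaWeight s m) : ℝ) : ℂ) • basisVec θ hθ m := by
    have h := ((orthonormal_basisVec θ hθ).orthogonalFamily.summable_iff_norm_sq_summable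
      (fun m => ((Real.sqrt (zetaWeight s m) : ℝ) : ℂ))).2 (by
        simpa [Real.sq_sqrt (zetaWeight_pos hs _).le] using (hasSum_zetaWeight hs).summable)
    simpa using h
  have he : psi θ hθ s = ∑' m, ((Real.sqrt (zetaWeight s m) : ℝ) : ℂ) • basisVec θ hθ m := by
    rw [psi, ← tsum_const_smul'']
    congr 1
    ext1 m
    rw [basisVec, smul_comm]
    rfl
  rw [he]
  exact hsum.hasSum

lemma inner_basisVec_psi (θ : ℝ) (hθ : 0 < θ) {s : ℝ} (hs : 1 < s) (m : ℕ) :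
    inner ℂ (basisVec θ hθ m) (psi θ hθ s) = (Real.sqrt (zetaWeight s m) : ℝ) := by
  have h := (hasSum_psi θ hθ hs).mapL (innerSL ℂ (basisVec θ hθ m))
  have h2 := hasSum_ite_eq m ((Real.sqrt (zetaWeight s m) : ℝ) : ℂ)
  have he : (fun k => innerSL ℂ (basisVec θ hθ m)
      (((Real.sqrt (zetaWeight s k) : ℝ) : ℂ) • basisVec θ hθ k)) =
      fun k => if k = m then ((Real.sqrt (zetaWeight s m) : ℝ) : ℂ) else 0 := by
    ext k
    rw [innerSL_apply_apply, inner_smul_right, orthonormal_iff_ite.1 (orthonormal_basisVec θ hθ)]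
    by_cases hk : k = m
    · simp [hk]
    · simp [hk, Ne.symm hk]
  rw [he] at h
  exact h.unique h2

/-- The expectation in `ψ(s)` of an operator which is diagonal in the basis. -/
lemma hasSum_inner_psi (θ : ℝ) (hθ : 0 < θ) {s : ℝ} (hs : 1 < s)
    (T : Lp ℂ 2 (volume : Measure Plane) →L[ℂ] Lp ℂ 2 (volume : Measure Plane)) (c : ℕ → ℝ)
    (hT : ∀ m, T (basisVec θ hθ m) = (c m : ℂ) • basisVec θ hθ m) :
    HasSum (fun m => ((zetaWeight s m * c m : ℝ) : ℂ))
      (inner ℂ (psi θ hθ s) (T (psi θ hθ s))) := by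
  have h := ((hasSum_psi θ hθ hs).mapL T).mapL (innerSL ℂ (psi θ hθ s))
  have he : (fun m => ((zetaWeight s m * c m : ℝ) : ℂ)) = fun m => innerSL ℂ (psi θ hθ s)
      (T (((Real.sqrt (zetaWeight s m) : ℝ) : ℂ) • basisVec θ hθ m)) := by
    ext m
    have hsq := Real.mul_self_sqrt (zetaWeight_pos hs m).le
    rw [map_smul, hT, innerSL_apply_apply, inner_smul_right, inner_smul_right,
      ← inner_conj_symm, inner_basisVec_psi θ hθ hs, Complex.conj_ofReal, ← Complex.ofReal_mul,
      ← Complex.ofReal_mul, mul_left_comm, hsq, mul_comm]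
  rw [he]
  exact h

/-- The diagonal expectation formula applied to the identity operator, with total weight one. -/
lemma norm_psi (θ : ℝ) (hθ : 0 < θ) {s : ℝ} (hs : 1 < s) : ‖psi θ hθ s‖ = 1 := by
  have h := hasSum_inner_psi θ hθ hs (ContinuousLinearMap.id ℂ _) (fun _ => 1) (fun m => by simp)
  simp only [mul_one, ContinuousLinearMap.id_apply] at h
  have h2 := h.unique (Complex.hasSum_ofReal.2 (hasSum_zetaWeight hs))
  have h3 := congrArg RCLike.re h2
  rw [inner_self_eq_norm_sq] at h3
  replace h3 : ‖psi θ hθ s‖ ^ 2 = 1 := by simpa using h3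
  exact (pow_eq_one_iff_of_nonneg (norm_nonneg _) two_ne_zero).1 h3

lemma leftMulCLM_basisVec (θ τ : ℝ) (hθ : 0 < θ) (hτ : 0 < τ) (r : ℝ) (m : ℕ) :
    leftMulCLM hθ (integral_smul_f00_mul_phase θ τ hθ hτ r) (basisVec θ hθ m) =
      ((r * (2 * τ / (τ + θ)) * ((τ - θ) / (τ + θ)) ^ m : ℝ) : ℂ) • basisVec θ hθ m := by
  rw [basisVec, map_smul, smul_comm]
  congr 1
  refine Lp.ext ?_
  filter_upwards [coeFn_leftMulCLM hθ (integral_smul_f00_mul_phase θ τ hθ hτ r)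
    ((basisFun θ hθ m).toLp 2 volume), Lp.coeFn_smul
    ((r * (2 * τ / (τ + θ)) * ((τ - θ) / (τ + θ)) ^ m : ℝ) : ℂ) ((basisFun θ hθ m).toLp 2 volume),
    (basisFun θ hθ m).coeFn_toLp 2 volume] with x h1 h2 h3
  rw [h1, h2, Pi.smul_apply, h3, smul_eq_mul,
    leftMul_congr ((basisFun θ hθ m).coeFn_toLp 2 volume), leftMul_f00_basisFun]

/-- Evaluating the state on Gaussians samples the generating function of the zeta distribution at `q
= (τ-θ)/(τ+θ)`. -/
lemma vectorState_psi_f00 (θ τ : ℝ) (hθ : 0 < θ) (hτ : 0 < τ) (r : ℝ) {s : ℝ} (hs : 1 < s) :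
    vectorState θ (psi θ hθ s) ((r : ℂ) • f00 τ hτ) = ((r * (2 * τ / (τ + θ)) *
      ∑' m, zetaWeight s m * ((τ - θ) / (τ + θ)) ^ m : ℝ) : ℂ) := by
  have h := hasSum_inner_psi θ hθ hs _ _ (leftMulCLM_basisVec θ τ hθ hτ r)
  rw [vectorState_eq_inner hθ (integral_smul_f00_mul_phase θ τ hθ hτ r), ← h.tsum_eq,
    ← Complex.ofReal_tsum, ← tsum_mul_left]
  congr 2
  ext1 m
  ring

/-! ### Divergence of the spectral distance -/

lemma spectralDist_comm (θ : ℝ) (ω₁ ω₂ : 𝓢(Plane, ℂ) → ℂ) :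
    spectralDist θ ω₁ ω₂ = spectralDist θ ω₂ ω₁ := by
  unfold spectralDist
  simp only [enorm_sub_rev (ω₁ _)]

theorem spectralDist_psi_eq_top (θ : ℝ) (hθ : 0 < θ) {s t : ℝ} (hs : 1 < s) (hst : s < t)
    (ht : t ≤ 3 / 2) :
    spectralDist θ (vectorState θ (psi θ hθ s)) (vectorState θ (psi θ hθ t)) = ⊤ := by
  obtain ⟨C, hC, hcomm⟩ := exists_commutatorNorm_gaussian_le θ hθ
  refine ENNReal.eq_top_of_forall_nnreal_le fun R => ?_
  obtain ⟨n, hn, hM⟩ := exists_lt_abs_tsum_zetaWeight_sub hs hst ht (R * C / Real.sqrt θ)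
  have hn' : (1 : ℝ) ≤ n := by exact_mod_cast hn
  -- The solution of `(τ-θ)/(τ+θ) = 1 - 1/n`.
  set τ : ℝ := θ * (2 * n - 1) with hτd
  have hτ : 0 < τ := mul_pos hθ (by linarith)
  have hτn : τ + θ = 2 * n * θ := by rw [hτd]; ring
  have hq : (τ - θ) / (τ + θ) = 1 - 1 / n := by
    rw [hτn, hτd]; field_simp; ring
  have hn0 : (0 : ℝ) < n := by linarith
  have hsτ : 0 < Real.sqrt τ := Real.sqrt_pos.2 hτ
  have hsθ : 0 < Real.sqrt θ := Real.sqrt_pos.2 hθ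
  -- The amplitude for which the bound `C r/√τ` on the commutator norm equals one.
  set r : ℝ := Real.sqrt τ / C with hr
  have hr0 : 0 < r := by positivity
  have hle : commutatorNorm θ ((r : ℂ) • f00 τ hτ) ≤ 1 := by
    refine (hcomm τ hτ r hr0.le).trans_eq ?_
    rw [hr, mul_div_cancel₀ _ hC.ne', div_self hsτ.ne', ENNReal.ofReal_one]
  refine le_trans ?_ (le_iSup₂ (f := fun (a : 𝓢(Plane, ℂ)) (_ : commutatorNorm θ a ≤ 1) =>
    ‖vectorState θ (psi θ hθ s) a - vectorState θ (psi θ hθ t) a‖ₑ) _ hle)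
  rw [vectorState_psi_f00 θ τ hθ hτ r hs, vectorState_psi_f00 θ τ hθ hτ r (hs.trans hst), hq,
    ← Complex.ofReal_sub, ← mul_sub, ← ofReal_norm, Complex.norm_real, Real.norm_eq_abs, abs_mul,
    abs_of_pos (by positivity)]
  rw [← ENNReal.ofReal_coe_nnreal]
  refine ENNReal.ofReal_le_ofReal ?_
  have h1 : 1 ≤ 2 * τ / (τ + θ) := by
    rw [le_div_iff₀ (by positivity), hτd]
    nlinarith
  -- The growth of `r` exactly compensates `√(1/n)`, since `τ/n ≥ θ`.
  have h2 : Real.sqrt θ ≤ Real.sqrt τ * Real.sqrt (1 / n) := by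
    rw [← Real.sqrt_mul hτ.le]
    refine Real.sqrt_le_sqrt ?_
    rw [hτd, mul_one_div, le_div_iff₀ hn0]
    nlinarith
  calc (R : ℝ) = Real.sqrt θ / C * (R * C / Real.sqrt θ) := by field_simp
    _ ≤ Real.sqrt τ * Real.sqrt (1 / n) / C * (R * C / Real.sqrt θ) := by gcongr
    _ = r * 1 * (R * C / Real.sqrt θ * Real.sqrt (1 / n)) := by rw [hr]; ring
    _ ≤ _ := by gcongr

end Moyal

theorem mainTheorem4 (θ : ℝ) (hθ : 0 < θ) (s₁ s₂ : ℝ)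
    (hs₁ : s₁ ∈ Set.Ioo (1 : ℝ) (5 / 4) ∪ Set.Ioc (5 / 4 : ℝ) (3 / 2))
    (hs₂ : s₂ ∈ Set.Ioo (1 : ℝ) (5 / 4) ∪ Set.Ioc (5 / 4 : ℝ) (3 / 2))
    (hne : s₁ ≠ s₂) :
    ‖Moyal.psi θ hθ s₁‖ = 1 ∧ ‖Moyal.psi θ hθ s₂‖ = 1 ∧
      Moyal.spectralDist θ (Moyal.vectorState θ (Moyal.psi θ hθ s₁))
        (Moyal.vectorState θ (Moyal.psi θ hθ s₂)) = ⊤ := by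
  have h1 : ∀ {s : ℝ}, s ∈ Set.Ioo (1 : ℝ) (5 / 4) ∪ Set.Ioc (5 / 4 : ℝ) (3 / 2) →
      1 < s ∧ s ≤ 3 / 2 := by
    rintro s (⟨h, h'⟩ | ⟨h, h'⟩) <;> constructor <;> linarith
  obtain ⟨h₁, h₁'⟩ := h1 hs₁
  obtain ⟨h₂, h₂'⟩ := h1 hs₂
  refine ⟨Moyal.norm_psi θ hθ h₁, Moyal.norm_psi θ hθ h₂, ?_⟩
  rcases hne.lt_or_gt with h | h
  -- The smaller exponent, with the heavier tail, must come first; symmetry of the distance covers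
  -- the other order.
  · exact Moyal.spectralDist_psi_eq_top θ hθ h₁ h h₂'
  · rw [Moyal.spectralDist_comm]
    exact Moyal.spectralDist_psi_eq_top θ hθ h₂ h h₁'
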